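/- Let $X$ be a complex Banach space and let $(A,B)$ be a Weyl pair of dimension $d$ on $X$: $A=(A_1,\dots,A_d)$ and $B=(B_1,\dots,B_d)$ are $d$-tuples of closed densely defined operators in $X$ such that each $iA_j$ and each $iB_j$ generates a uniformly bounded $C_0$-group, denoted $(e^{itA_j})_{t\in\mathbb R}$ and $(e^{itB_j})_{t\in\mathbb R}$, and for all $s,t\in\mathbb R$ and $1\le j,k\le d$ $$e^{isA_j}e^{itA_k}=e^{itA_k}e^{isA_j},\qquad e^{isB_j}e^{itB_k}=e^{itB_k}e^{isB_j},\qquad e^{isA_j}e^{itB_k}=e^{-ist\delta_{jk}}e^{itB_k}e^{isA_j}.$$ For $u,v\in\mathbb R^d$ put $e^{i(uA+vB)}:=e^{\frac12 i\,u\cdot v}\prod_{j=1}^d e^{iu_jA_j}\prod_{k=1}^d e^{iv_kB_k}$, and for a Schwartz function $a$ on $\mathbb R^{2d}$ let $a(A,B)$ be the bounded operator $$a(A,B)f:=\frac1{(2\pi)^d}\int_{\mathbb R^{2d}}\widehat a(u,v)\,e^{i(uA+vB)}f\,du\,dv,\qquad \widehat a(u,v):=\frac1{(2\pi)^d}\int_{\mathbb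 R^{2d}}a(x,\xi)e^{-i(x\cdot u+\xi\cdot v)}\,dx\,d\xi .$$ Let $A^2:=\sum_{j}A_j^2$ and $B^2:=\sum_jB_j^2$ with domains $D(A^2):=\bigcap_jD(A_j^2)$ and $D(B^2):=\bigcap_jD(B_j^2)$. For $t>0$ let $$P(t):=a_t(A,B),\qquad a_t(x,\xi):=(1+\lambda_t)^d e^{-\lambda_t(|x|^2+|\xi|^2)},\qquad \lambda_t:=\frac{1-e^{-t}}{1+e^{-t}},$$ and let $P(0):=I$. **Theorem.** $(P(t))_{t\ge0}$ is a uniformly bounded $C_0$-semigroup on $X$. The subspace $D(A^2)\cap D(B^2)$ is dense in $X$ and is a core for the generator $-L$ of this semigroup, and on this core $L=\frac12(A^2+B^2)-\frac12 d$. Moreover, $(P(t))_{t\ge0}$ extends to an analytic semigroup of angle $\frac12\pi$, that is, to a family $(P(z))$ of bounded operators, holomorphic and satisfying $P(z+w)=P(z)P(w)$ on $\{z\ne0,\ |\arg z|<\frac12\pi\}$, which on every sector $\{z\neq 0,\ |\arg z|<\theta\}$ with $0<\theta<\frac12\pi$ is uniformly bounded and strongly continuous (also at the origin). -/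

import Mathlib

open Complex Filter MeasureTheory Set
open scoped Topology SchwartzMap

noncomputable section

/-! ### Strongly continuous groups and semigroups, generators -/

section Semigroups

variable {X : Type*} [NormedAddCommGroup X] [NormedSpace ℂ X]

/-- `U` is a uniformly bounded `C₀`-group of bounded operators on `X`. -/
structure IsBoundedC0Group (U : ℝ → X →L[ℂ] X) : Prop where
  map_zero : U 0 = 1
  map_add : ∀ s t : ℝ, U (s + t) = U s * U t
  continuous_apply : ∀ f : X, Continuous fun t => U t f
  bounded : ∃ M : ℝ, ∀ t : ℝ, ‖U t‖ ≤ M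

/-- `(T t)_{t ≥ 0}` is a `C₀`-semigroup of bounded operators on `X`
(the values of `T` at negative times are irrelevant). -/
structure IsC0Semigroup (T : ℝ → X →L[ℂ] X) : Prop where
  map_zero : T 0 = 1
  map_add : ∀ s t : ℝ, 0 ≤ s → 0 ≤ t → T (s + t) = T s * T t
  continuousOn_apply : ∀ f : X, ContinuousOn (fun t => T t f) (Ici 0)

/-- The operator `f ↦ lim (T t f - f) / t`, the limit being along the filter `l` on `ℝ`; its domain
consists of all `f` for which the limit exists. With `l = 𝓝[>] 0` this is the generator of a
`C₀`-semigroup `T`, with `l = 𝓝[≠] 0` it is the generator of a `C₀`-group `T`. -/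
def generator (l : Filter ℝ) [l.NeBot] (T : ℝ → X →L[ℂ] X) : X →ₗ.[ℂ] X where
  domain :=
    { carrier := {f | ∃ g : X, Tendsto (fun t : ℝ => (t : ℂ)⁻¹ • (T t f - f)) l (𝓝 g)}
      zero_mem' := ⟨0, by simp⟩
      add_mem' := by
        rintro f₁ f₂ ⟨g₁, h₁⟩ ⟨g₂, h₂⟩
        refine ⟨g₁ + g₂, (h₁.add h₂).congr fun t => ?_⟩
        rw [← smul_add, map_add]
        congr 1
        abel
      smul_mem' := by
        rintro c f ⟨g, h⟩
        refine ⟨c • g, (h.const_smul c).congr fun t => ?_⟩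
        rw [smul_comm, smul_sub, map_smul] }
  toFun :=
    { toFun := fun f => limUnder l fun t : ℝ => (t : ℂ)⁻¹ • (T t (f : X) - (f : X))
      map_add' := by
        rintro ⟨f₁, g₁, h₁⟩ ⟨f₂, g₂, h₂⟩
        refine Tendsto.limUnder_eq ?_
        rw [h₁.limUnder_eq, h₂.limUnder_eq]
        refine (h₁.add h₂).congr fun t => ?_
        rw [← smul_add, Submodule.coe_add, map_add]
        congr 1
        abel
      map_smul' := by
        rintro c ⟨f, g, h⟩
        refine Tendsto.limUnder_eq ?_
        rw [h.limUnder_eq]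
        refine (h.const_smul c).congr fun t => ?_
        rw [Submodule.coe_smul, smul_comm, smul_sub, map_smul] }

/-- The graph of the generator. -/
theorem mem_graph_generator {l : Filter ℝ} [l.NeBot] {T : ℝ → X →L[ℂ] X} {f g : X} :
    (f, g) ∈ (generator l T).graph ↔
      Tendsto (fun t : ℝ => (t : ℂ)⁻¹ • (T t f - f)) l (𝓝 g) := by
  rw [LinearPMap.mem_graph_iff]
  constructor
  · rintro ⟨⟨y, g', hg'⟩, rfl, hy⟩
    have h : (generator l T) ⟨y, g', hg'⟩ = g' := hg'.limUnder_eq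
    have h2 : g' = g := h.symm.trans hy
    exact h2 ▸ hg'
  · intro h
    exact ⟨⟨f, g, h⟩, rfl, h.limUnder_eq⟩

/-- The square `f ↦ A (A f)` of an unbounded operator,
with domain `{f ∈ D(A) | A f ∈ D(A)}`. -/
def unboundedSq (A : X →ₗ.[ℂ] X) : X →ₗ.[ℂ] X :=
  A.comp (A.domRestrict ((A.domain.comap A.toFun).map A.domain.subtype)) (by
    rintro ⟨f, hf, hfA⟩
    obtain ⟨y, hy, rfl⟩ := hf
    have h : A.domRestrict ((A.domain.comap A.toFun).map A.domain.subtype)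
        ⟨A.domain.subtype y, ⟨y, hy, rfl⟩, hfA⟩ = A y :=
      LinearPMap.domRestrict_apply rfl
    rw [h]
    exact hy)

/-- The graph of the square. -/
theorem mem_graph_unboundedSq {A : X →ₗ.[ℂ] X} {f h : X} :
    (f, h) ∈ (unboundedSq A).graph ↔ ∃ g : X, (f, g) ∈ A.graph ∧ (g, h) ∈ A.graph := by
  constructor
  · intro hf
    obtain ⟨⟨x, hx⟩, hxf, hxh⟩ := (LinearPMap.mem_graph_iff _).1 hf
    obtain ⟨⟨y, hy, hyx⟩, hxA⟩ := hx
    simp only at hxf hxh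
    subst hxf
    refine ⟨A ⟨x, hxA⟩, A.mem_graph ⟨x, hxA⟩, ?_⟩
    have key := A.mem_graph ⟨_, (show A ⟨x, hxA⟩ ∈ A.domain by
      have : y = ⟨x, hxA⟩ := Subtype.ext hyx
      exact this ▸ hy)⟩
    rw [← hxh]
    exact key
  · rintro ⟨g, hfg, hgh⟩
    obtain ⟨x, hx, hxg⟩ := (LinearPMap.mem_graph_iff _).1 hfg
    obtain ⟨y, hy, hyh⟩ := (LinearPMap.mem_graph_iff _).1 hgh
    simp only at hx hxg hy hyh
    subst hx hxg hyh
    have hxm : A x ∈ A.domain := hy ▸ y.2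
    have hmem : (x : X) ∈ (unboundedSq A).domain := ⟨⟨x, hxm, rfl⟩, x.2⟩
    have : (unboundedSq A) ⟨x, hmem⟩ = A y := congrArg A.toFun (Subtype.ext hy.symm)
    rw [← this]
    exact (unboundedSq A).mem_graph ⟨x, hmem⟩

/-- The open sector `{z ≠ 0, |arg z| < θ}` in the complex plane. -/
def sector (θ : ℝ) : Set ℂ := {z | z ≠ 0 ∧ |arg z| < θ}

/-- `T` is an analytic `C₀`-semigroup of angle `θ` on `X` (with `0 < θ ≤ π / 2`): it is holomorphic
and satisfies the semigroup law on the sector of angle `θ`, `T 0 = I`, and `T` is strongly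
continuous, up to the origin, on each sector of smaller angle. -/
structure IsAnalyticSemigroup (θ : ℝ) (T : ℂ → X →L[ℂ] X) : Prop where
  map_zero : T 0 = 1
  map_add : ∀ z ∈ sector θ, ∀ w ∈ sector θ, T (z + w) = T z * T w
  differentiableOn : DifferentiableOn ℂ T (sector θ)
  continuousOn_apply : ∀ η : ℝ, 0 < η → η < θ → ∀ f : X,
    ContinuousOn (fun z => T z f) (insert 0 (sector η))

end Semigroups

/-! ### Weyl pairs and the Weyl calculus -/

/-- The phase space `ℝ^{2d} = ℝ^d × ℝ^d`, with its Euclidean norm and Lebesgue measure. For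
`z = (x, ξ)` the coordinates are `x_j = z (Sum.inl j)` and `ξ_j = z (Sum.inr j)`. -/
abbrev PhaseSpace (d : ℕ) : Type := EuclideanSpace ℝ (Fin d ⊕ Fin d)

/-- A Weyl pair `(A, B)` of dimension `d` on `X`: two `d`-tuples of closed densely defined operators
such that `i A_j` and `i B_j` generate uniformly bounded `C₀`-groups, written `e^{itA_j} = expA j t`
and `e^{itB_j} = expB j t`, that satisfy the integrated canonical commutation relations. -/
structure WeylPair (d : ℕ) (X : Type*) [NormedAddCommGroup X] [NormedSpace ℂ X] where
  A : Fin d → X →ₗ.[ℂ] X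
  B : Fin d → X →ₗ.[ℂ] X
  expA : Fin d → ℝ → X →L[ℂ] X
  expB : Fin d → ℝ → X →L[ℂ] X
  isClosed_A : ∀ j, (A j).IsClosed
  isClosed_B : ∀ j, (B j).IsClosed
  dense_A : ∀ j, Dense ((A j).domain : Set X)
  dense_B : ∀ j, Dense ((B j).domain : Set X)
  group_A : ∀ j, IsBoundedC0Group (expA j)
  group_B : ∀ j, IsBoundedC0Group (expB j)
  generator_A : ∀ j, generator (𝓝[≠] (0 : ℝ)) (expA j) = I • A j
  generator_B : ∀ j, generator (𝓝[≠] (0 : ℝ)) (expB j) = I • B j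
  comm_A : ∀ (j k : Fin d) (s t : ℝ), expA j s * expA k t = expA k t * expA j s
  comm_B : ∀ (j k : Fin d) (s t : ℝ), expB j s * expB k t = expB k t * expB j s
  ccr : ∀ (j k : Fin d) (s t : ℝ),
    expA j s * expB k t =
      Complex.exp (-(I * s * t * (if j = k then 1 else 0))) • (expB k t * expA j s)

section Symbols

/-- The Fourier--Plancherel transform
`â(u, v) = (2π)^{-d} ∫ a(x, ξ) e^{-i(x·u + ξ·v)} dx dξ` of a Schwartz function on `ℝ^{2d}`. -/
def fourierPlancherel {d : ℕ} (a : 𝓢(PhaseSpace d, ℂ)) (w : PhaseSpace d) : ℂ :=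
  ((2 * (Real.pi : ℂ)) ^ d)⁻¹ *
    ∫ z : PhaseSpace d, a z * Complex.exp (-(I * ((inner ℝ z w : ℝ) : ℂ)))

theorem integrable_fourierPlancherel {d : ℕ} (a : 𝓢(PhaseSpace d, ℂ)) :
    Integrable (fourierPlancherel a) := by
  have h1 : Integrable (fun w : PhaseSpace d => (FourierTransform.fourier a) w) :=
    (FourierTransform.fourier a : 𝓢(PhaseSpace d, ℂ)).integrable
  have h2 := (h1.comp_smul (R := (2 * Real.pi)⁻¹) (by positivity)).const_mul
    (((2 * (Real.pi : ℂ)) ^ d)⁻¹)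
  refine h2.congr (Eventually.of_forall fun w => ?_)
  simp only [fourierPlancherel]
  congr 1
  rw [SchwartzMap.fourier_coe, Real.fourier_eq']
  refine integral_congr_ae (Eventually.of_forall fun z => ?_)
  simp only [smul_eq_mul]
  rw [mul_comm, inner_smul_right]
  congr 2
  push_cast
  have : (Real.pi : ℂ) ≠ 0 := by exact_mod_cast Real.pi_ne_zero
  field_simp

theorem one_add_pow_mul_exp_le (N : ℕ) {c r : ℝ} (hc : 0 < c) (hr : 0 ≤ r) :
    (1 + r) ^ N * Real.exp (-c * r ^ 2) ≤ (N.factorial : ℝ) * Real.exp (1 + 1 / (4 * c)) := by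
  have h1 : (1 + r) ^ N ≤ (N.factorial : ℝ) * Real.exp (1 + r) := by
    have := Real.pow_div_factorial_le_exp (1 + r) (by positivity) N
    rwa [div_le_iff₀ (by positivity), mul_comm] at this
  have h2 : 1 + r + -c * r ^ 2 ≤ 1 + 1 / (4 * c) := by
    have : 1 / (4 * c) - r + c * r ^ 2 = (2 * c * r - 1) ^ 2 / (4 * c) := by
      field_simp
      ring
    have h3 : 0 ≤ (2 * c * r - 1) ^ 2 / (4 * c) := by positivity
    linarith
  calc (1 + r) ^ N * Real.exp (-c * r ^ 2)
      ≤ (N.factorial : ℝ) * Real.exp (1 + r) * Real.exp (-c * r ^ 2) := by gcongr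
    _ = (N.factorial : ℝ) * Real.exp (1 + r + -c * r ^ 2) := by rw [mul_assoc, ← Real.exp_add]
    _ ≤ _ := by gcongr

/-- The Gaussian `z ↦ exp (-c |z|²)`, `c > 0`, as a Schwartz function. -/
def gaussianSchwartz (d : ℕ) (c : ℝ) (hc : 0 < c) : 𝓢(PhaseSpace d, ℂ) where
  toFun z := ((Real.exp (-c * ‖z‖ ^ 2) : ℝ) : ℂ)
  smooth' := by
    have h : ContDiff ℝ ((⊤ : ℕ∞) : WithTop ℕ∞) fun z : PhaseSpace d => ‖z‖ ^ 2 :=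
      contDiff_norm_sq ℝ
    exact Complex.ofRealCLM.contDiff.comp (Real.contDiff_exp.comp (contDiff_const.mul h))
  decay' := by
    intro k n
    have hsq : ContDiff ℝ n fun z : PhaseSpace d => ‖z‖ ^ 2 := contDiff_norm_sq ℝ
    have hexp : ContDiff ℝ n fun y : ℝ => Real.exp (-c * y) := by fun_prop
    obtain ⟨p, C, hC, hp⟩ := (Function.hasTemperateGrowth_norm_sq
      (H := PhaseSpace d)).norm_iteratedFDeriv_le_uniform n
    refine ⟨(n.factorial : ℝ) * (1 + c) ^ n * (C + 1) ^ n *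
      (((k + p * n).factorial : ℝ) * Real.exp (1 + 1 / (4 * c))), fun z => ?_⟩
    have h1 : ‖iteratedFDeriv ℝ n (fun z : PhaseSpace d =>
        ((Real.exp (-c * ‖z‖ ^ 2) : ℝ) : ℂ)) z‖ =
        ‖iteratedFDeriv ℝ n (fun z : PhaseSpace d => Real.exp (-c * ‖z‖ ^ 2)) z‖ :=
      Complex.ofRealLI.norm_iteratedFDeriv_comp_left (hexp.comp hsq).contDiffAt le_rfl
    have h2 : ‖iteratedFDeriv ℝ n (fun z : PhaseSpace d => Real.exp (-c * ‖z‖ ^ 2)) z‖ ≤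
        (n.factorial : ℝ) * ((1 + c) ^ n * Real.exp (-c * ‖z‖ ^ 2)) *
          ((C + 1) * (1 + ‖z‖) ^ p) ^ n := by
      refine norm_iteratedFDeriv_comp_le hexp hsq le_rfl z (fun i hi => ?_) fun i hi hin => ?_
      · rw [norm_iteratedFDeriv_eq_norm_iteratedDeriv, iteratedDeriv_exp_const_mul]
        simp only [norm_mul, norm_pow, norm_neg, Real.norm_eq_abs, abs_of_pos hc, Real.abs_exp]
        gcongr
        exact (pow_le_pow_left₀ hc.le (by linarith) i).trans
          (pow_le_pow_right₀ (by linarith) hi)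
      · have hge : 1 ≤ (C + 1) * (1 + ‖z‖) ^ p :=
          one_le_mul_of_one_le_of_one_le (by linarith)
            (one_le_pow₀ (by linarith [norm_nonneg z]))
        refine (hp i hin z).trans (le_trans ?_ (le_self_pow₀ hge (by omega)))
        gcongr
        linarith
    have h3 := one_add_pow_mul_exp_le (k + p * n) hc (norm_nonneg z)
    rw [h1]
    calc ‖z‖ ^ k * _ ≤ (1 + ‖z‖) ^ k * ((n.factorial : ℝ) *
          ((1 + c) ^ n * Real.exp (-c * ‖z‖ ^ 2)) * ((C + 1) * (1 + ‖z‖) ^ p) ^ n) := by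
          gcongr
          linarith
      _ = (n.factorial : ℝ) * (1 + c) ^ n * (C + 1) ^ n *
          ((1 + ‖z‖) ^ (k + p * n) * Real.exp (-c * ‖z‖ ^ 2)) := by
          rw [mul_pow, ← pow_mul, pow_add]
          ring
      _ ≤ _ := by gcongr

/-- `λ_t = (1 - e^{-t}) / (1 + e^{-t})`. -/
def mehlerParam (t : ℝ) : ℝ := (1 - Real.exp (-t)) / (1 + Real.exp (-t))

theorem mehlerParam_pos {t : ℝ} (ht : 0 < t) : 0 < mehlerParam t := by
  have h1 : Real.exp (-t) < 1 := by simpa using ht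
  have h2 := Real.exp_pos (-t)
  exact div_pos (by linarith) (by linarith)

/-- The symbol `a_t(x, ξ) = (1 + λ_t)^d exp (-λ_t (|x|² + |ξ|²))`, `t > 0`. -/
def mehlerSymbol (d : ℕ) (t : ℝ) (ht : 0 < t) : 𝓢(PhaseSpace d, ℂ) :=
  ((1 + (mehlerParam t : ℂ)) ^ d) • gaussianSchwartz d (mehlerParam t) (mehlerParam_pos ht)

theorem mehlerSymbol_apply (d : ℕ) (t : ℝ) (ht : 0 < t) (z : PhaseSpace d) :
    mehlerSymbol d t ht z = (1 + (mehlerParam t : ℂ)) ^ d *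
      ((Real.exp (-mehlerParam t *
        (∑ j, z (Sum.inl j) ^ 2 + ∑ j, z (Sum.inr j) ^ 2)) : ℝ) : ℂ) := by
  have h : ‖z‖ ^ 2 = ∑ j, z (Sum.inl j) ^ 2 + ∑ j, z (Sum.inr j) ^ 2 := by
    simp [EuclideanSpace.norm_sq_eq]
  rw [← h]
  rfl

end Symbols

section Products

variable {X : Type*} [NormedAddCommGroup X] [NormedSpace ℂ X]

/-- The product `U_1(s_1) ⋯ U_d(s_d)`. -/
def groupProd {d : ℕ} (U : Fin d → ℝ → X →L[ℂ] X) (s : Fin d → ℝ) : X →L[ℂ] X :=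
  (List.ofFn fun j => U j (s j)).prod

theorem continuous_apply_of_bounded {Y : Type*} [TopologicalSpace Y] {S : Y → X →L[ℂ] X} {g : Y → X}
    (hS : ∀ f, Continuous fun y => S y f) (hb : ∃ M : ℝ, ∀ y, ‖S y‖ ≤ M) (hg : Continuous g) :
    Continuous fun y => S y (g y) := by
  obtain ⟨M, hM⟩ := hb
  rw [continuous_iff_continuousAt]
  intro y₀
  have h1 : Tendsto (fun y => S y (g y - g y₀)) (𝓝 y₀) (𝓝 0) := by
    refine squeeze_zero_norm (a := fun y => M * ‖g y - g y₀‖)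
      (fun y => ((S y).le_opNorm _).trans (by gcongr; exact hM y)) ?_
    have : Tendsto (fun y => M * ‖g y - g y₀‖) (𝓝 y₀) (𝓝 (M * ‖g y₀ - g y₀‖)) :=
      (Continuous.tendsto (by fun_prop) y₀)
    simpa using this
  have h2 := h1.add ((hS (g y₀)).tendsto y₀)
  simpa [ContinuousAt] using h2

theorem groupProd_bounded_continuous {d : ℕ} {U : Fin d → ℝ → X →L[ℂ] X}
    (hU : ∀ j, IsBoundedC0Group (U j)) :
    (∃ M : ℝ, ∀ s, ‖groupProd U s‖ ≤ M) ∧ ∀ f, Continuous fun s => groupProd U s f := by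
  induction d with
  | zero => exact ⟨⟨‖(1 : X →L[ℂ] X)‖, fun s => by simp [groupProd]⟩,
      fun f => by simpa [groupProd] using continuous_const⟩
  | succ n ih =>
    obtain ⟨⟨M, hM⟩, hc⟩ := ih (U := fun j => U j.succ) fun j => hU _
    have key : ∀ s : Fin (n + 1) → ℝ,
        groupProd U s = U 0 (s 0) * groupProd (fun j => U j.succ) fun j => s j.succ := by
      intro s
      simp [groupProd, List.ofFn_succ]
    obtain ⟨M₀, hM₀⟩ := (hU 0).bounded
    constructor
    · refine ⟨M₀ * M, fun s => ?_⟩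
      rw [key]
      refine (norm_mul_le _ _).trans ?_
      have := (norm_nonneg _).trans (hM₀ 0)
      gcongr
      · exact hM₀ _
      · exact hM _
    · intro f
      simp only [key]
      exact continuous_apply_of_bounded (S := fun s : Fin (n + 1) → ℝ => U 0 (s 0))
        (fun g => ((hU 0).continuous_apply g).comp (continuous_apply 0)) ⟨M₀, fun s => hM₀ _⟩
        ((hc f).comp (by fun_prop))

end Products

namespace WeylPair

variable {d : ℕ} {X : Type*} [NormedAddCommGroup X] [NormedSpace ℂ X] (W : WeylPair d X)

/-- `e^{i(uA + vB)} = e^{i u·v / 2} e^{iuA} e^{ivB}`, where `w = (u, v)`,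
`e^{iuA} = ∏ e^{i u_j A_j}` and `e^{ivB} = ∏ e^{i v_j B_j}`. -/
def weylExp (w : PhaseSpace d) : X →L[ℂ] X :=
  Complex.exp (I / 2 * ∑ j, (w (Sum.inl j) : ℂ) * (w (Sum.inr j) : ℂ)) •
    (groupProd W.expA (fun j => w (Sum.inl j)) * groupProd W.expB (fun j => w (Sum.inr j)))

theorem norm_weylExp_le : ∃ M : ℝ, ∀ w, ‖W.weylExp w‖ ≤ M := by
  obtain ⟨⟨M₁, h₁⟩, -⟩ := groupProd_bounded_continuous W.group_A
  obtain ⟨⟨M₂, h₂⟩, -⟩ := groupProd_bounded_continuous W.group_B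
  refine ⟨M₁ * M₂, fun w => ?_⟩
  have h0 := (norm_nonneg _).trans (h₁ 0)
  have he : ‖Complex.exp (I / 2 * ∑ j, (w (Sum.inl j) : ℂ) * (w (Sum.inr j) : ℂ))‖ = 1 := by
    have : I / 2 * ∑ j, (w (Sum.inl j) : ℂ) * (w (Sum.inr j) : ℂ) =
        ((1 / 2 * ∑ j, w (Sum.inl j) * w (Sum.inr j) : ℝ) : ℂ) * I := by
      push_cast
      ring
    rw [this, Complex.norm_exp_ofReal_mul_I]
  rw [weylExp, norm_smul, he, one_mul]
  refine (norm_mul_le _ _).trans ?_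
  gcongr
  · exact h₁ _
  · exact h₂ _

theorem continuous_weylExp_apply (f : X) : Continuous fun w => W.weylExp w f := by
  obtain ⟨hb, hc⟩ := groupProd_bounded_continuous W.group_A
  obtain ⟨-, hc'⟩ := groupProd_bounded_continuous W.group_B
  simp only [weylExp, smul_apply]
  refine Continuous.smul (by fun_prop) ?_
  obtain ⟨M, hM⟩ := hb
  exact continuous_apply_of_bounded
    (S := fun w : PhaseSpace d => groupProd W.expA fun j => w (Sum.inl j))
    (fun g => (hc g).comp (by fun_prop)) ⟨M, fun w => hM _⟩ ((hc' f).comp (by fun_prop))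

theorem integrable_weyl (a : 𝓢(PhaseSpace d, ℂ)) (f : X) :
    Integrable fun w => fourierPlancherel a w • W.weylExp w f := by
  obtain ⟨M, hM⟩ := W.norm_weylExp_le
  refine (((integrable_fourierPlancherel a).norm.mul_const (M * ‖f‖))).mono'
    ((integrable_fourierPlancherel a).aestronglyMeasurable.smul
      (W.continuous_weylExp_apply f).aestronglyMeasurable) (Eventually.of_forall fun w => ?_)
  rw [norm_smul]
  gcongr
  exact ((W.weylExp w).le_opNorm f).trans (by gcongr; exact hM w)

/-- The Weyl calculus of the pair `(A, B)`: for a Schwartz function `a` on `ℝ^{2d}`,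
`a(A, B) f = (2π)^{-d} ∫ â(u, v) e^{i(uA + vB)} f du dv`. -/
def weylCalculus (a : 𝓢(PhaseSpace d, ℂ)) : X →L[ℂ] X :=
  LinearMap.mkContinuousOfExistsBound
    { toFun := fun f => ((2 * (Real.pi : ℂ)) ^ d)⁻¹ •
        ∫ w : PhaseSpace d, fourierPlancherel a w • W.weylExp w f
      map_add' := fun f g => by
        rw [← smul_add, ← integral_add (W.integrable_weyl a f) (W.integrable_weyl a g)]
        simp only [map_add, smul_add]
      map_smul' := fun c f => by
        rw [RingHom.id_apply, smul_comm c, ← integral_smul c]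
        simp only [map_smul, smul_comm c] }
    (by
      obtain ⟨M, hM⟩ := W.norm_weylExp_le
      refine ⟨‖((2 * (Real.pi : ℂ)) ^ d)⁻¹‖ *
        ((∫ w : PhaseSpace d, ‖fourierPlancherel a w‖) * M), fun f => ?_⟩
      simp only [LinearMap.coe_mk, AddHom.coe_mk]
      rw [norm_smul, mul_assoc]
      gcongr
      rw [mul_assoc, ← integral_mul_const]
      refine norm_integral_le_of_norm_le
        ((integrable_fourierPlancherel a).norm.mul_const (M * ‖f‖))
        (Eventually.of_forall fun w => ?_)
      rw [norm_smul]
      gcongr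
      exact ((W.weylExp w).le_opNorm f).trans (by gcongr; exact hM w))

theorem weylCalculus_apply (a : 𝓢(PhaseSpace d, ℂ)) (f : X) :
    W.weylCalculus a f = ((2 * (Real.pi : ℂ)) ^ d)⁻¹ •
      ∫ w : PhaseSpace d, fourierPlancherel a w • W.weylExp w f := rfl

/-- `P(t) = a_t(A, B)` for `t > 0` and `P(0) = I`. -/
def mehler (t : ℝ) : X →L[ℂ] X :=
  if ht : 0 < t then W.weylCalculus (mehlerSymbol d t ht) else 1

/-- `A² = ∑ A_j²`, with domain `D(A²) = ⋂ D(A_j²)`. -/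
def sqA : X →ₗ.[ℂ] X := ∑ j, unboundedSq (W.A j)

/-- `B² = ∑ B_j²`, with domain `D(B²) = ⋂ D(B_j²)`. -/
def sqB : X →ₗ.[ℂ] X := ∑ j, unboundedSq (W.B j)

theorem mem_domain_sum {ι : Type*} (s : Finset ι) (S : ι → X →ₗ.[ℂ] X) (f : X) :
    f ∈ (∑ j ∈ s, S j).domain ↔ ∀ j ∈ s, f ∈ (S j).domain := by
  classical
  induction s using Finset.induction_on with
  | empty => simp
  | insert a s ha ih =>
    rw [Finset.sum_insert ha, LinearPMap.add_domain, Submodule.mem_inf, ih]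
    simp

/-- The operator `L`, defined by `-L` being the generator of `(P(t))_{t ≥ 0}`. -/
def L : X →ₗ.[ℂ] X := -generator (𝓝[>] (0 : ℝ)) W.mehler

end WeylPair

end

/-!
The operators `P(t)` are given by Gaussian kernels. For an integrable function `φ` on phase space
let `W.weylOp φ f = ∫ φ(w) e^{i(uA + vB)} f dw`, `w = (u, v)`. The Fourier transform of the symbol
`a_t` is again a Gaussian, and `P(t) = c(t) W.weylOp (exp (-α(t) ‖·‖²))` with `q = e^{-t}`, `α(t)
= (1 + q) / (4 (1 - q))` and `c(t) = (2π (1 - q))^{-d}`. These formulas make sense for `Re t > 0`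
and define the analytic extension `W.mehlerExt`.

*Semigroup law.* By the Weyl relations (`WeylPair.weylExp_mul`), products of operators `W.weylOp
φ` correspond to twisted convolutions of the kernels. The twisted convolution of two Gaussians is
a Gaussian (`integral_gaussianKernel_twisted`), and the parameters combine as in the addition
theorem of `coth` (`mehlerRate_add`).

*Analyticity and boundedness.* The operator norm of `W.weylOp φ` is at most a constant times the
`L¹`-norm of `φ`. Hence `P(z)` is holomorphic in norm because the Gaussian depends holomorphically
on its parameter in `L¹`. The `L¹`-norm of the kernel of `P(z)` is `(2 |1 - q| / (1 - |q|²))^d`,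
which is bounded on each sector of angle less than `π / 2`, and the kernels form an approximate
identity as `z → 0` in such a sector.

*The generator.* As `P` is differentiable at positive times, `(f, g)` lies in the graph of the
generator if and only if `P'(t) f = P(t) g` for all `t > 0`
(`mem_graph_generator_iff_of_hasDerivAt`). This shows that the generator is closed, and it reduces
the formula for the generator on `D(A²) ∩ D(B²)` to an identity for `P(t)(A² + B²) f`.
Differentiating `W.weylOp φ` times a Weyl operator moves `A_j` and `B_j` onto the kernel as the
first order operators `-∂_i ± (i / 2) (J w)_i`, where `J (u, v) = (v, -u)`; only the pure squares
`A_j²` and `B_j²` occur, so no mixed products of the operators have to be defined on `D(A²) ∩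
D(B²)`. The identity is then the differential equation of the kernel in `t`. The same computation
from the left shows that `P(t)` maps `X` into `D(A²) ∩ D(B²)` for `t > 0`, so that this space is
dense and a core.
-/

/-! ### The Weyl relations -/

section GroupProducts

variable {X : Type*} [NormedAddCommGroup X] [NormedSpace ℂ X]

theorem groupProd_succ {n : ℕ} (U : Fin (n + 1) → ℝ → X →L[ℂ] X) (s : Fin (n + 1) → ℝ) :
    groupProd U s = U 0 (s 0) * groupProd (fun j => U j.succ) fun j => s j.succ := by
  simp [groupProd, List.ofFn_succ]

/-- Moving an operator through a product, when it commutes with each factor up to a scalar. -/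
theorem groupProd_mul_eq_smul {d : ℕ} {U : Fin d → ℝ → X →L[ℂ] X} {s : Fin d → ℝ}
    {V : X →L[ℂ] X} {χ : Fin d → ℂ} (h : ∀ j, U j (s j) * V = χ j • (V * U j (s j))) :
    groupProd U s * V = (∏ j, χ j) • (V * groupProd U s) := by
  induction d with
  | zero => simp [groupProd]
  | succ n ih =>
    rw [groupProd_succ, mul_assoc, ih fun j => h j.succ, mul_smul_comm, ← mul_assoc, h 0,
      smul_mul_assoc, smul_smul, Fin.prod_univ_succ, mul_assoc, mul_comm (χ 0)]

theorem groupProd_zero {d : ℕ} {U : Fin d → ℝ → X →L[ℂ] X} (h0 : ∀ j, U j 0 = 1) :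
    groupProd U 0 = 1 := by
  simp [groupProd, h0, List.ofFn_const]

theorem groupProd_single {d : ℕ} {U : Fin d → ℝ → X →L[ℂ] X} (h0 : ∀ j, U j 0 = 1)
    (j : Fin d) (s : ℝ) : groupProd U (Pi.single j s) = U j s := by
  induction d with
  | zero => exact j.elim0
  | succ n ih =>
    rw [groupProd_succ]
    refine Fin.cases ?_ (fun k => ?_) j
    · have : (fun k : Fin n => (Pi.single 0 s : Fin (n + 1) → ℝ) k.succ) = 0 := by
        ext k
        simp
      rw [this, groupProd_zero fun j => h0 _]
      simp
    · have : (fun i : Fin n => (Pi.single k.succ s : Fin (n + 1) → ℝ) i.succ) = Pi.single k s := by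
        ext i
        simp [Pi.single_apply]
      rw [this, ih fun j => h0 _, Pi.single_eq_of_ne (Fin.succ_ne_zero k).symm, h0, one_mul]

theorem groupProd_add {d : ℕ} {U : Fin d → ℝ → X →L[ℂ] X}
    (hU : ∀ j s t, U j (s + t) = U j s * U j t)
    (hc : ∀ j k s t, U j s * U k t = U k t * U j s) (s t : Fin d → ℝ) :
    groupProd U (s + t) = groupProd U s * groupProd U t := by
  induction d with
  | zero => simp [groupProd]
  | succ n ih =>
    have h := groupProd_mul_eq_smul (U := fun j => U j.succ) (s := fun j => s j.succ)
      (V := U 0 (t 0)) (χ := 1) fun j => by simpa using hc j.succ 0 _ _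
    have h2 := ih (U := fun j => U j.succ) (fun j => hU _) (fun j k => hc _ _)
      (fun j => s j.succ) fun j => t j.succ
    simp only [Pi.one_apply, Finset.prod_const_one, one_smul] at h
    rw [groupProd_succ, groupProd_succ U s, groupProd_succ U t, mul_assoc,
      ← mul_assoc (groupProd _ _), h, Pi.add_apply, hU]
    simp only [mul_assoc]
    rw [← h2]
    rfl

end GroupProducts

section Symplectic

variable {d : ℕ}

/-- The coordinates of `J w = (v, -u)`, where `w = (u, v)`. -/
def symplecticRot (w : PhaseSpace d) : Fin d ⊕ Fin d → ℝ :=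
  Sum.elim (fun j => w (Sum.inr j)) fun j => -w (Sum.inl j)

/-- The symplectic form `σ(w, w') = J w · w' = v · u' - u · v'`. -/
def symplectic (w w' : PhaseSpace d) : ℝ := ∑ i, symplecticRot w i * w' i

theorem symplectic_eq (w w' : PhaseSpace d) : symplectic w w' =
    ∑ j, w (Sum.inr j) * w' (Sum.inl j) - ∑ j, w (Sum.inl j) * w' (Sum.inr j) := by
  simp [symplectic, symplecticRot, Fintype.sum_sum_type, sub_eq_add_neg]

theorem symplectic_self (w : PhaseSpace d) : symplectic w w = 0 := by
  rw [symplectic_eq, sub_eq_zero]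
  exact Finset.sum_congr rfl fun j _ => mul_comm _ _

theorem symplectic_swap (w w' : PhaseSpace d) : symplectic w' w = -symplectic w w' := by
  simp only [symplectic_eq, neg_sub, mul_comm]

theorem symplectic_sub_left (w w' v : PhaseSpace d) :
    symplectic (w - w') v = symplectic w v - symplectic w' v := by
  simp only [symplectic_eq, PiLp.sub_apply, sub_mul, Finset.sum_sub_distrib]
  ring

theorem symplectic_smul_right (s : ℝ) (w w' : PhaseSpace d) :
    symplectic w (s • w') = s * symplectic w w' := by
  simp only [symplectic, PiLp.smul_apply, smul_eq_mul, Finset.mul_sum]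
  exact Finset.sum_congr rfl fun i _ => by ring

theorem symplectic_single (w : PhaseSpace d) (i : Fin d ⊕ Fin d) :
    symplectic w (EuclideanSpace.single i 1) = symplecticRot w i := by
  simp [symplectic]

theorem sum_symplecticRot_sq (w : PhaseSpace d) : ∑ i, symplecticRot w i ^ 2 = ‖w‖ ^ 2 := by
  simp [symplecticRot, Fintype.sum_sum_type, EuclideanSpace.norm_sq_eq, add_comm]

theorem continuous_symplecticRot (i : Fin d ⊕ Fin d) :
    Continuous fun w : PhaseSpace d => symplecticRot w i := by
  cases i <;> simp only [symplecticRot, Sum.elim_inl, Sum.elim_inr] <;> fun_prop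

theorem continuous_symplectic : Continuous fun p : PhaseSpace d × PhaseSpace d =>
    symplectic p.1 p.2 := by
  simp only [symplectic_eq]
  fun_prop

theorem abs_symplecticRot_le (w : PhaseSpace d) (i : Fin d ⊕ Fin d) :
    |symplecticRot w i| ≤ ‖w‖ := by
  refine abs_le_of_sq_le_sq (a := symplecticRot w i) ?_ (norm_nonneg w)
  rw [← sum_symplecticRot_sq]
  exact Finset.single_le_sum (f := fun i => symplecticRot w i ^ 2) (fun _ _ => sq_nonneg _)
    (Finset.mem_univ i)

theorem norm_exp_I_div_two_mul (x : ℝ) : ‖Complex.exp (I / 2 * x)‖ = 1 := by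
  have : I / 2 * (x : ℂ) = ((x / 2 : ℝ) : ℂ) * I := by
    push_cast
    ring
  rw [this, Complex.norm_exp_ofReal_mul_I]

end Symplectic

namespace WeylPair

variable {d : ℕ} {X : Type*} [NormedAddCommGroup X] [NormedSpace ℂ X] (W : WeylPair d X)

theorem groupProd_expB_mul_groupProd_expA (u v : Fin d → ℝ) :
    groupProd W.expB v * groupProd W.expA u =
      Complex.exp (I * ∑ j, (u j : ℂ) * v j) • (groupProd W.expA u * groupProd W.expB v) := by
  have h1 : ∀ k, W.expB k (v k) * groupProd W.expA u =
      Complex.exp (I * (u k * v k)) • (groupProd W.expA u * W.expB k (v k)) := by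
    intro k
    rw [groupProd_mul_eq_smul fun j => W.ccr j k (u j) (v k), smul_smul, ← Complex.exp_sum,
      ← Complex.exp_add]
    simp [mul_assoc]
  rw [groupProd_mul_eq_smul h1, ← Complex.exp_sum, Finset.mul_sum]

/-- The Weyl relations: `w ↦ e^{i(uA + vB)}` is a projective representation of phase space, whose
cocycle is given by the symplectic form. -/
theorem weylExp_mul (w w' : PhaseSpace d) : W.weylExp w * W.weylExp w' =
    Complex.exp (I / 2 * symplectic w w') • W.weylExp (w + w') := by
  have hA := groupProd_add (fun j => (W.group_A j).map_add) W.comm_A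
    (fun j => w (Sum.inl j)) fun j => w' (Sum.inl j)
  have hB := groupProd_add (fun j => (W.group_B j).map_add) W.comm_B
    (fun j => w (Sum.inr j)) fun j => w' (Sum.inr j)
  have h := W.groupProd_expB_mul_groupProd_expA (fun j => w' (Sum.inl j)) fun j => w (Sum.inr j)
  have hA' : groupProd W.expA (fun j => (w + w') (Sum.inl j)) = _ := hA
  have hB' : groupProd W.expB (fun j => (w + w') (Sum.inr j)) = _ := hB
  rw [weylExp, weylExp, weylExp, hA', hB', smul_mul_smul_comm, smul_smul,
    show ∀ a b c e : X →L[ℂ] X, a * b * (c * e) = a * (b * c) * e from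
      fun a b c e => by simp only [mul_assoc], h, mul_smul_comm, smul_mul_assoc, smul_smul,
    ← Complex.exp_add, ← Complex.exp_add, ← Complex.exp_add]
  congr 1
  · congr 1
    rw [symplectic_eq]
    push_cast
    simp only [PiLp.add_apply, ofReal_add, add_mul, mul_add, Finset.sum_add_distrib]
    have h1 : ∑ j, (w' (Sum.inl j) : ℂ) * (w (Sum.inr j) : ℂ) =
      ∑ j, (w (Sum.inr j) : ℂ) * (w' (Sum.inl j) : ℂ) := by simp only [mul_comm]
    rw [h1]
    ring

/-- The operators `A_1, …, A_d, B_1, …, B_d` as one tuple. -/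
def op (i : Fin d ⊕ Fin d) : X →ₗ.[ℂ] X := Sum.elim W.A W.B i

/-- The groups generated by `i A_1, …, i A_d, i B_1, …, i B_d` are the restrictions of the Weyl
operators to the coordinate axes. -/
theorem generator_weylExp_single (i : Fin d ⊕ Fin d) :
    generator (𝓝[≠] (0 : ℝ)) (fun s => W.weylExp (s • EuclideanSpace.single i 1)) =
      I • W.op i := by
  cases i with
  | inl j =>
    have : (fun s : ℝ => W.weylExp (s • EuclideanSpace.single (Sum.inl j) 1)) = W.expA j := by
      ext1 s
      have h1 : (fun k => (s • EuclideanSpace.single (Sum.inl j) 1 : PhaseSpace d) (Sum.inl k)) =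
        Pi.single j s := by ext k; simp [Pi.single_apply]
      have h2 : (fun k => (s • EuclideanSpace.single (Sum.inl j) 1 : PhaseSpace d) (Sum.inr k)) =
        0 := by ext k; simp
      rw [weylExp, h1, h2, groupProd_zero fun j => (W.group_B j).map_zero,
        groupProd_single fun j => (W.group_A j).map_zero]
      simp
    rw [this]
    exact W.generator_A j
  | inr j =>
    have : (fun s : ℝ => W.weylExp (s • EuclideanSpace.single (Sum.inr j) 1)) = W.expB j := by
      ext1 s
      have h1 : (fun k => (s • EuclideanSpace.single (Sum.inr j) 1 : PhaseSpace d) (Sum.inr k)) =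
        Pi.single j s := by ext k; simp [Pi.single_apply]
      have h2 : (fun k => (s • EuclideanSpace.single (Sum.inr j) 1 : PhaseSpace d) (Sum.inl k)) =
        0 := by ext k; simp
      rw [weylExp, h1, h2, groupProd_zero fun j => (W.group_A j).map_zero,
        groupProd_single fun j => (W.group_B j).map_zero]
      simp
    rw [this]
    exact W.generator_B j

theorem weylExp_zero : W.weylExp 0 = 1 := by
  have hA := groupProd_zero fun j => (W.group_A j).map_zero
  have hB := groupProd_zero fun j => (W.group_B j).map_zero
  simp only [weylExp, PiLp.zero_apply]
  change _ • (groupProd W.expA 0 * groupProd W.expB 0) = 1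
  simp [hA, hB]

/-- The graph of `A_j` or `B_j` in terms of the derivative of the group it generates. -/
theorem mem_graph_op {i : Fin d ⊕ Fin d} {f g : X} : (f, g) ∈ (W.op i).graph ↔
    HasDerivAt (fun s : ℝ => W.weylExp (s • EuclideanSpace.single i 1) f) (I • g) 0 := by
  have h1 : (f, g) ∈ (W.op i).graph ↔ (f, I • g) ∈ (I • W.op i).graph := by
    simp only [LinearPMap.mem_graph_iff, LinearPMap.smul_apply]
    constructor
    · rintro ⟨y, hy, h⟩
      exact ⟨y, hy, by rw [h]⟩
    · rintro ⟨y, hy, h⟩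
      exact ⟨y, hy, smul_right_injective X I_ne_zero h⟩
  rw [h1, ← W.generator_weylExp_single, mem_graph_generator, hasDerivAt_iff_tendsto_slope_zero]
  refine tendsto_congr fun t => ?_
  simp only [zero_add, zero_smul, weylExp_zero, one_apply_eq_self]
  rw [← ofReal_inv, Complex.coe_smul]

end WeylPair

/-! ### The integrated Weyl representation -/

namespace WeylPair

variable {d : ℕ} {X : Type*} [NormedAddCommGroup X] [NormedSpace ℂ X] (W : WeylPair d X)

theorem integrable_smul_weylExp {φ : PhaseSpace d → ℂ} (hφ : Integrable φ) (f : X) :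
    Integrable fun w => φ w • W.weylExp w f := by
  obtain ⟨M, hM⟩ := W.norm_weylExp_le
  refine (hφ.norm.mul_const (M * ‖f‖)).mono'
    (hφ.aestronglyMeasurable.smul (W.continuous_weylExp_apply f).aestronglyMeasurable)
    (Eventually.of_forall fun w => ?_)
  rw [norm_smul]
  gcongr
  exact ((W.weylExp w).le_opNorm f).trans (by gcongr; exact hM w)

theorem norm_integral_smul_weylExp_le {M : ℝ} (hM : ∀ w, ‖W.weylExp w‖ ≤ M)
    {φ : PhaseSpace d → ℂ} (hφ : Integrable φ) (f : X) :
    ‖∫ w, φ w • W.weylExp w f‖ ≤ M * (∫ w, ‖φ w‖) * ‖f‖ := by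
  rw [mul_comm M, mul_assoc, ← integral_mul_const]
  refine norm_integral_le_of_norm_le (hφ.norm.mul_const _) (Eventually.of_forall fun w => ?_)
  rw [norm_smul]
  gcongr
  exact ((W.weylExp w).le_opNorm f).trans (by gcongr; exact hM w)

open Classical in
/-- The integrated representation `f ↦ ∫ φ(w) e^{i(uA + vB)} f dw`, `w = (u, v)`, of an integrable
function `φ` on phase space; it is `0` if `φ` is not integrable. -/
noncomputable def weylOp (φ : PhaseSpace d → ℂ) : X →L[ℂ] X :=
  if hφ : Integrable φ then
    LinearMap.mkContinuousOfExistsBound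
      { toFun := fun f => ∫ w, φ w • W.weylExp w f
        map_add' := fun f g => by
          rw [← integral_add (W.integrable_smul_weylExp hφ f) (W.integrable_smul_weylExp hφ g)]
          simp only [map_add, smul_add]
        map_smul' := fun c f => by
          rw [RingHom.id_apply, ← integral_smul c]
          simp only [map_smul, smul_comm c] }
      (W.norm_weylExp_le.elim fun _ hM => ⟨_, W.norm_integral_smul_weylExp_le hM hφ⟩)
  else 0

theorem weylOp_apply {φ : PhaseSpace d → ℂ} (hφ : Integrable φ) (f : X) :
    W.weylOp φ f = ∫ w, φ w • W.weylExp w f := by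
  rw [weylOp, dif_pos hφ]
  rfl

theorem norm_weylOp_le {M : ℝ} (hM : ∀ w, ‖W.weylExp w‖ ≤ M)
    {φ : PhaseSpace d → ℂ} (hφ : Integrable φ) : ‖W.weylOp φ‖ ≤ M * ∫ w, ‖φ w‖ := by
  have hM0 := (norm_nonneg _).trans (hM 0)
  refine ContinuousLinearMap.opNorm_le_bound _ (by positivity) fun f => ?_
  rw [W.weylOp_apply hφ]
  exact W.norm_integral_smul_weylExp_le hM hφ f

theorem weylOp_add {φ ψ : PhaseSpace d → ℂ} (hφ : Integrable φ) (hψ : Integrable ψ) :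
    W.weylOp (fun w => φ w + ψ w) = W.weylOp φ + W.weylOp ψ := by
  ext f
  rw [add_apply, W.weylOp_apply hφ, W.weylOp_apply hψ,
    W.weylOp_apply (φ := fun w => φ w + ψ w) (hφ.add hψ),
    ← integral_add (W.integrable_smul_weylExp hφ f) (W.integrable_smul_weylExp hψ f)]
  simp only [add_smul]

theorem weylOp_const_mul {φ : PhaseSpace d → ℂ} (hφ : Integrable φ) (c : ℂ) :
    W.weylOp (fun w => c * φ w) = c • W.weylOp φ := by
  ext f
  rw [smul_apply, W.weylOp_apply hφ, W.weylOp_apply (hφ.const_mul c), ← integral_smul]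
  simp only [mul_smul]

theorem weylOp_sum {ι : Type*} (s : Finset ι) {φ : ι → PhaseSpace d → ℂ}
    (hφ : ∀ i ∈ s, Integrable (φ i)) :
    W.weylOp (fun w => ∑ i ∈ s, φ i w) = ∑ i ∈ s, W.weylOp (φ i) := by
  ext f
  rw [W.weylOp_apply (integrable_finsetSum s hφ), sum_apply]
  simp only [Finset.sum_smul]
  rw [integral_finsetSum s fun i hi => W.integrable_smul_weylExp (hφ i hi) f]
  exact Finset.sum_congr rfl fun i hi => (W.weylOp_apply (hφ i hi) f).symm

theorem weylExp_weylExp_apply (w w' : PhaseSpace d) (f : X) : W.weylExp w (W.weylExp w' f) =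
    Complex.exp (I / 2 * symplectic w w') • W.weylExp (w + w') f := by
  rw [← smul_apply, ← weylExp_mul]
  rfl

theorem weylOp_weylExp_apply {φ : PhaseSpace d → ℂ} (hφ : Integrable φ) (v : PhaseSpace d)
    (f : X) : W.weylOp φ (W.weylExp v f) =
      ∫ w, (φ (w - v) * Complex.exp (I / 2 * symplectic w v)) • W.weylExp w f := by
  rw [W.weylOp_apply hφ, ← integral_sub_right_eq_self _ v]
  refine integral_congr_ae (Eventually.of_forall fun w => ?_)
  simp only [weylExp_weylExp_apply, smul_smul, symplectic_sub_left, symplectic_self, sub_zero,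
    sub_add_cancel]

theorem weylExp_weylOp_apply [CompleteSpace X] {φ : PhaseSpace d → ℂ} (hφ : Integrable φ)
    (v : PhaseSpace d) (f : X) : W.weylExp v (W.weylOp φ f) =
      ∫ w, (φ (w - v) * Complex.exp (-(I / 2 * symplectic w v))) • W.weylExp w f := by
  rw [W.weylOp_apply hφ,
    ← ContinuousLinearMap.integral_comp_comm _ (W.integrable_smul_weylExp hφ f),
    ← integral_sub_right_eq_self _ v]
  refine integral_congr_ae (Eventually.of_forall fun w => ?_)
  have : symplectic v (w - v) = -symplectic w v := by
    rw [symplectic_swap, symplectic_sub_left, symplectic_self, sub_zero]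
  simp only [map_smul, weylExp_weylExp_apply, smul_smul, this, add_sub_cancel, ofReal_neg, mul_neg]

/-- The integrated representation turns the twisted convolution of functions into the product of
operators. -/
theorem weylOp_mul [CompleteSpace X] {φ ψ : PhaseSpace d → ℂ} (hφ : Integrable φ)
    (hψ : Integrable ψ) : W.weylOp φ * W.weylOp ψ =
      W.weylOp fun w' => ∫ w, φ w * ψ (w' - w) * Complex.exp (I / 2 * symplectic w w') := by
  have hexp : Continuous fun p : PhaseSpace d × PhaseSpace d =>
      Complex.exp (I / 2 * symplectic p.2 p.1) := by
    have := (continuous_symplectic (d := d)).comp continuous_swap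
    simp only [Function.comp_def, Prod.fst_swap, Prod.snd_swap] at this
    fun_prop
  have h0 : Integrable (fun p : PhaseSpace d × PhaseSpace d => φ p.2 * ψ (p.1 - p.2) *
      Complex.exp (I / 2 * symplectic p.2 p.1)) (volume.prod volume) := by
    have h := hφ.convolution_integrand (ContinuousLinearMap.mul ℂ ℂ) hψ
    refine h.mono (h.aestronglyMeasurable.mul hexp.aestronglyMeasurable)
      (Eventually.of_forall fun p => ?_)
    rw [norm_mul, norm_exp_I_div_two_mul, mul_one]
    rfl
  obtain ⟨M, hM⟩ := W.norm_weylExp_le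
  ext f
  have h1 : Integrable (fun p : PhaseSpace d × PhaseSpace d => (φ p.2 * ψ (p.1 - p.2) *
      Complex.exp (I / 2 * symplectic p.2 p.1)) • W.weylExp p.1 f) (volume.prod volume) := by
    refine (h0.norm.mul_const (M * ‖f‖)).mono' (h0.aestronglyMeasurable.smul
      ((W.continuous_weylExp_apply f).comp continuous_fst).aestronglyMeasurable)
      (Eventually.of_forall fun p => ?_)
    rw [norm_smul]
    gcongr
    exact ((W.weylExp _).le_opNorm f).trans (by gcongr; exact hM _)
  change W.weylOp φ (W.weylOp ψ f) = _
  rw [W.weylOp_apply hφ, W.weylOp_apply h0.integral_prod_left,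
    W.weylOp_apply hψ]
  simp_rw [← integral_smul_const]
  rw [integral_integral_swap h1]
  refine integral_congr_ae (Eventually.of_forall fun w => ?_)
  simp only
  rw [← ContinuousLinearMap.integral_comp_comm _ (W.integrable_smul_weylExp hψ f),
    ← integral_sub_right_eq_self _ w, ← integral_smul]
  refine integral_congr_ae (Eventually.of_forall fun w' => ?_)
  have : symplectic w (w' - w) = symplectic w w' := by
    rw [symplectic_swap, symplectic_sub_left, symplectic_self, symplectic_swap w w']
    ring
  simp only [map_smul, weylExp_weylExp_apply, smul_smul, add_sub_cancel, this, mul_assoc]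

end WeylPair

/-! ### Rapidly decaying kernels -/

/-- A continuous function on phase space that decays faster than every power of `‖w‖`. -/
structure IsRapidlyDecaying {d : ℕ} (φ : PhaseSpace d → ℂ) : Prop where
  continuous : Continuous φ
  decay : ∀ N : ℕ, ∃ C, ∀ w, (1 + ‖w‖) ^ N * ‖φ w‖ ≤ C

namespace IsRapidlyDecaying

variable {d : ℕ} {φ ψ : PhaseSpace d → ℂ}

/-- A bound by an integrable function that is uniform under translations of length at most `1`. -/
theorem exists_integrable_bound (hφ : IsRapidlyDecaying φ) : ∃ b : PhaseSpace d → ℝ,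
    Integrable b ∧ ∀ w v, ‖v‖ ≤ 1 → ‖φ (w - v)‖ ≤ b w := by
  obtain ⟨C, hC⟩ := hφ.decay (2 * d + 1)
  refine ⟨fun w => 2 ^ (2 * d + 1) * C * (1 + ‖w‖) ^ (-((2 * d + 1 : ℕ) : ℝ)),
    (integrable_one_add_norm ?_).const_mul _, fun w v hv => ?_⟩
  · simp only [finrank_euclideanSpace, Fintype.card_sum, Fintype.card_fin]
    push_cast
    linarith
  · have h1 : 1 + ‖w‖ ≤ 2 * (1 + ‖w - v‖) := by
      have := norm_sub_norm_le w v
      have := norm_nonneg (w - v)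
      linarith
    have h2 : 0 < 1 + ‖w‖ := by positivity
    simp only
    rw [Real.rpow_neg h2.le, Real.rpow_natCast, ← div_eq_mul_inv, le_div_iff₀ (by positivity)]
    calc ‖φ (w - v)‖ * (1 + ‖w‖) ^ (2 * d + 1)
        ≤ ‖φ (w - v)‖ * (2 * (1 + ‖w - v‖)) ^ (2 * d + 1) := by gcongr
      _ = 2 ^ (2 * d + 1) * ((1 + ‖w - v‖) ^ (2 * d + 1) * ‖φ (w - v)‖) := by
          rw [mul_pow]
          ring
      _ ≤ _ := by
          gcongr
          exact hC _

theorem integrable (hφ : IsRapidlyDecaying φ) : Integrable φ := by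
  obtain ⟨b, hb, h⟩ := hφ.exists_integrable_bound
  exact hb.mono' hφ.continuous.aestronglyMeasurable
    (Eventually.of_forall fun w => by simpa using h w 0 (by simp))

theorem add (hφ : IsRapidlyDecaying φ) (hψ : IsRapidlyDecaying ψ) :
    IsRapidlyDecaying fun w => φ w + ψ w := by
  refine ⟨hφ.continuous.add hψ.continuous, fun N => ?_⟩
  obtain ⟨C, hC⟩ := hφ.decay N
  obtain ⟨C', hC'⟩ := hψ.decay N
  refine ⟨C + C', fun w => le_trans ?_ (add_le_add (hC w) (hC' w))⟩
  rw [← mul_add]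
  gcongr
  exact norm_add_le _ _

theorem mul_of_norm_le (hφ : IsRapidlyDecaying φ) {p : PhaseSpace d → ℂ} (hp : Continuous p)
    {K : ℝ} (m : ℕ) (hK : ∀ w, ‖p w‖ ≤ K * (1 + ‖w‖) ^ m) :
    IsRapidlyDecaying fun w => p w * φ w := by
  refine ⟨hp.mul hφ.continuous, fun N => ?_⟩
  obtain ⟨C, hC⟩ := hφ.decay (N + m)
  have hK0 : 0 ≤ K := by simpa using (norm_nonneg _).trans (hK 0)
  refine ⟨K * C, fun w => ?_⟩
  rw [norm_mul]
  calc (1 + ‖w‖) ^ N * (‖p w‖ * ‖φ w‖) ≤ (1 + ‖w‖) ^ N * (K * (1 + ‖w‖) ^ m * ‖φ w‖) := by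
        gcongr
        exact hK w
    _ = K * ((1 + ‖w‖) ^ (N + m) * ‖φ w‖) := by ring
    _ ≤ K * C := by
        gcongr
        exact hC w

theorem const_mul (hφ : IsRapidlyDecaying φ) (c : ℂ) : IsRapidlyDecaying fun w => c * φ w :=
  hφ.mul_of_norm_le continuous_const (K := ‖c‖) 0 (by simp)

end IsRapidlyDecaying

namespace WeylPair

variable {d : ℕ} {X : Type*} [NormedAddCommGroup X] [NormedSpace ℂ X] (W : WeylPair d X)

/-- Differentiation of the twisted translates `w ↦ k(w - s v) e^{i c s σ(w, v) / 2}` of a kernel,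
where `k'` is the derivative of `k` in the direction `v`. The values `c = 1` and `c = -1` occur for
the multiplication of `W.weylOp k` by Weyl operators from the right and from the left. -/
theorem hasDerivAt_integral_twisted {k k' : PhaseSpace d → ℂ} {v : PhaseSpace d} (hv : ‖v‖ ≤ 1)
    (c : ℝ) (hk : IsRapidlyDecaying k)
    (hh : IsRapidlyDecaying fun w => -k' w + I / 2 * c * symplectic w v * k w)
    (hd : ∀ w, HasDerivAt (fun s : ℝ => k (w + s • v)) (k' w) 0) (f : X) :
    HasDerivAt (fun s : ℝ => ∫ w, (k (w - s • v) *
        Complex.exp (I / 2 * ((c * (s * symplectic w v) : ℝ) : ℂ))) • W.weylExp w f)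
      (W.weylOp (fun w => -k' w + I / 2 * c * symplectic w v * k w) f) 0 := by
  obtain ⟨M, hM⟩ := W.norm_weylExp_le
  have hM0 := (norm_nonneg _).trans (hM 0)
  obtain ⟨b, hb, hbound⟩ := hh.exists_integrable_bound
  set h : PhaseSpace d → ℂ := fun w => -k' w + I / 2 * c * symplectic w v * k w with hh_def
  have hσ : Continuous fun w : PhaseSpace d => symplectic w v :=
    continuous_symplectic.comp (by fun_prop : Continuous fun w : PhaseSpace d => (w, v))
  have hmeas : ∀ {φ : PhaseSpace d → ℂ}, IsRapidlyDecaying φ → ∀ s : ℝ, Continuous fun w =>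
      (φ (w - s • v) * Complex.exp (I / 2 * ((c * (s * symplectic w v) : ℝ) : ℂ))) •
        W.weylExp w f := fun hφ s => by
    have h1 := hφ.continuous
    have h2 := W.continuous_weylExp_apply f
    fun_prop
  have key := hasDerivAt_integral_of_dominated_loc_of_deriv_le (𝕜 := ℝ) (x₀ := 0)
    (s := Metric.ball 0 1)
    (bound := fun w => b w * (M * ‖f‖)) (μ := volume)
    (F := fun s w => (k (w - s • v) *
        Complex.exp (I / 2 * ((c * (s * symplectic w v) : ℝ) : ℂ))) • W.weylExp w f)
    (F' := fun s w => (h (w - s • v) *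
        Complex.exp (I / 2 * ((c * (s * symplectic w v) : ℝ) : ℂ))) • W.weylExp w f)
    (Metric.ball_mem_nhds _ one_pos)
    (Eventually.of_forall fun s => (hmeas hk s).aestronglyMeasurable)
    (by simpa using W.integrable_smul_weylExp hk.integrable f)
    (hmeas hh 0).aestronglyMeasurable ?_ (hb.mul_const _) ?_
  · convert key.2 using 1
    rw [W.weylOp_apply hh.integrable]
    simp [hh_def]
  · refine Eventually.of_forall fun w s hs => ?_
    rw [norm_smul, norm_mul, norm_exp_I_div_two_mul, mul_one]
    have hsv : ‖s • v‖ ≤ 1 := by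
      rw [norm_smul]
      exact mul_le_one₀ (by simpa using (mem_ball_zero_iff.1 hs).le) (norm_nonneg _) hv
    exact mul_le_mul (hbound w _ hsv) (((W.weylExp _).le_opNorm f).trans (by gcongr; exact hM _))
      (norm_nonneg _) ((norm_nonneg _).trans (hbound w _ hsv))
  · refine Eventually.of_forall fun w s _ => HasDerivAt.smul_const ?_ _
    have h1 : HasDerivAt (fun r : ℝ => k (w - r • v)) (-k' (w - s • v)) s := by
      have h2 : HasDerivAt (fun r : ℝ => s - r) (-1) s := by
        simpa using (hasDerivAt_id s).const_sub s
      have h3 : HasDerivAt (fun r : ℝ => k (w - s • v + r • v)) (k' (w - s • v)) (s - s) := by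
        rw [sub_self]
        exact hd _
      have h4 := h3.scomp s h2
      simp only [neg_smul, one_smul] at h4
      refine h4.congr_of_eventuallyEq (Eventually.of_forall fun r => ?_)
      simp only [Function.comp_apply]
      congr 1
      module
    have h5 : HasDerivAt (fun r : ℝ => Complex.exp (I / 2 * ((c * (r * symplectic w v) : ℝ) : ℂ)))
        (Complex.exp (I / 2 * ((c * (s * symplectic w v) : ℝ) : ℂ)) *
          (I / 2 * ((c * (1 * symplectic w v) : ℝ) : ℂ))) s :=
      ((((hasDerivAt_id s).mul_const _).const_mul c).ofReal_comp.const_mul (I / 2)).cexp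
    refine (h1.mul h5).congr_deriv ?_
    have h6 : symplectic (w - s • v) v = symplectic w v := by
      rw [symplectic_sub_left, symplectic_swap v (s • v), symplectic_smul_right, symplectic_self]
      ring
    rw [hh_def]
    simp only [h6]
    push_cast
    ring

/-- For `g = A_j f` or `g = B_j f`, the product of `W.weylOp k` and `i g` is the image of `f` under
the operator with a differentiated kernel. -/
theorem weylOp_apply_of_mem_graph {i : Fin d ⊕ Fin d} {f g : X} (hfg : (f, g) ∈ (W.op i).graph)
    {k k' : PhaseSpace d → ℂ} (hk : IsRapidlyDecaying k)
    (hh : IsRapidlyDecaying fun w => -k' w + I / 2 * (1 : ℝ) * symplecticRot w i * k w)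
    (hd : ∀ w, HasDerivAt (fun s : ℝ => k (w + s • EuclideanSpace.single i 1)) (k' w) 0) :
    W.weylOp k (I • g) =
      W.weylOp (fun w => -k' w + I / 2 * (1 : ℝ) * symplecticRot w i * k w) f := by
  have h1 := (W.weylOp k).restrictScalars ℝ |>.hasFDerivAt.comp_hasDerivAt
    (0 : ℝ) (W.mem_graph_op.1 hfg)
  simp only [← symplectic_single] at hh ⊢
  have h2 := W.hasDerivAt_integral_twisted (v := EuclideanSpace.single i 1) (by simp) 1 hk hh hd f
  refine h1.unique (h2.congr_of_eventuallyEq (Eventually.of_forall fun s => ?_))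
  simp only [Function.comp_apply, ContinuousLinearMap.coe_restrictScalars', one_mul]
  rw [W.weylOp_weylExp_apply hk.integrable]
  simp only [symplectic_smul_right]

/-- The range of an operator with rapidly decaying kernel is contained in the domains of `A_j` and
`B_j`. -/
theorem weylOp_apply_mem_graph [CompleteSpace X] {i : Fin d ⊕ Fin d}
    {k k' : PhaseSpace d → ℂ} (hk : IsRapidlyDecaying k)
    (hh : IsRapidlyDecaying fun w => -k' w + I / 2 * (-1 : ℝ) * symplecticRot w i * k w)
    (hd : ∀ w, HasDerivAt (fun s : ℝ => k (w + s • EuclideanSpace.single i 1)) (k' w) 0) (f : X) :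
    (W.weylOp k f, -(I • W.weylOp
      (fun w => -k' w + I / 2 * (-1 : ℝ) * symplecticRot w i * k w) f)) ∈ (W.op i).graph := by
  rw [mem_graph_op, smul_neg, smul_smul, I_mul_I, neg_one_smul, neg_neg]
  simp only [← symplectic_single] at hh ⊢
  have h2 := W.hasDerivAt_integral_twisted (v := EuclideanSpace.single i 1) (by simp) (-1) hk hh hd
    f
  refine h2.congr_of_eventuallyEq (Eventually.of_forall fun s => ?_)
  simp only [W.weylExp_weylOp_apply hk.integrable, symplectic_smul_right]
  refine integral_congr_ae (Eventually.of_forall fun w => ?_)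
  simp

end WeylPair

/-! ### Gaussian kernels -/

section Gaussian

variable {d : ℕ}

/-- The Gaussian `w ↦ exp (-α ‖w‖²)` with complex parameter. -/
noncomputable def gaussianKernel (α : ℂ) (w : PhaseSpace d) : ℂ :=
  Complex.exp (-α * ((‖w‖ : ℝ) : ℂ) ^ 2)

theorem norm_gaussianKernel (α : ℂ) (w : PhaseSpace d) :
    ‖gaussianKernel α w‖ = Real.exp (-α.re * ‖w‖ ^ 2) := by
  rw [gaussianKernel, Complex.norm_exp, ← ofReal_pow, re_mul_ofReal, neg_re]

theorem isRapidlyDecaying_gaussianKernel {α : ℂ} (hα : 0 < α.re) :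
    IsRapidlyDecaying (gaussianKernel α : PhaseSpace d → ℂ) := by
  refine ⟨by unfold gaussianKernel; fun_prop,
    fun N => ⟨N.factorial * Real.exp (1 + 1 / (4 * α.re)), fun w => ?_⟩⟩
  rw [norm_gaussianKernel]
  exact one_add_pow_mul_exp_le N hα (norm_nonneg w)

theorem integral_gaussianKernel {α : ℂ} (hα : 0 < α.re) :
    ∫ w : PhaseSpace d, gaussianKernel α w = (Real.pi / α) ^ d := by
  simp only [gaussianKernel]
  rw [GaussianFourier.integral_cexp_neg_mul_sq_norm hα]
  simp only [finrank_euclideanSpace, Fintype.card_sum, Fintype.card_fin]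
  rw [show (((d + d : ℕ) : ℂ) / 2) = (d : ℂ) by push_cast; ring, cpow_natCast]

theorem integral_norm_gaussianKernel {α : ℂ} (hα : 0 < α.re) :
    ∫ w : PhaseSpace d, ‖gaussianKernel α w‖ = (Real.pi / α.re) ^ d := by
  simp only [norm_gaussianKernel]
  rw [GaussianFourier.integral_rexp_neg_mul_sq_norm hα]
  simp only [finrank_euclideanSpace, Fintype.card_sum, Fintype.card_fin]
  rw [show (((d + d : ℕ) : ℝ) / 2) = (d : ℝ) by push_cast; ring, Real.rpow_natCast]

theorem ofReal_norm_sq (w : PhaseSpace d) : ((‖w‖ : ℝ) : ℂ) ^ 2 = ∑ i, (w i : ℂ) ^ 2 := by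
  rw [← ofReal_pow, EuclideanSpace.norm_sq_eq]
  push_cast
  simp [← ofReal_pow]

theorem sum_symplecticRot_mul_self (w : PhaseSpace d) :
    ∑ i, (symplecticRot w i : ℂ) * (w i : ℂ) = 0 := by
  have := symplectic_self w
  unfold symplectic at this
  exact_mod_cast this

theorem sum_sq_add_symplecticRot (w : PhaseSpace d) (a b : ℂ) :
    ∑ i, (a * (w i : ℂ) + b * (symplecticRot w i : ℂ)) ^ 2 =
      (a ^ 2 + b ^ 2) * ((‖w‖ : ℝ) : ℂ) ^ 2 := by
  have h1 : ∑ i, (symplecticRot w i : ℂ) ^ 2 = ((‖w‖ : ℝ) : ℂ) ^ 2 := by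
    exact_mod_cast sum_symplecticRot_sq w
  have h2 : ∀ i, (a * (w i : ℂ) + b * (symplecticRot w i : ℂ)) ^ 2 = a ^ 2 * (w i : ℂ) ^ 2 +
      b ^ 2 * (symplecticRot w i : ℂ) ^ 2 + 2 * a * b * ((symplecticRot w i : ℂ) * (w i : ℂ)) :=
    fun i => by ring
  simp only [h2, Finset.sum_add_distrib, ← Finset.mul_sum, h1, sum_symplecticRot_mul_self,
    ← ofReal_norm_sq]
  ring

/-- The twisted convolution of two Gaussians is a Gaussian. -/
theorem integral_gaussianKernel_twisted {α β : ℂ} (hα : 0 < α.re) (hβ : 0 < β.re)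
    (w' : PhaseSpace d) :
    ∫ w, gaussianKernel α w * gaussianKernel β (w' - w) * Complex.exp (I / 2 * symplectic w w') =
      (Real.pi / (α + β)) ^ d * gaussianKernel ((α * β + 1 / 16) / (α + β)) w' := by
  have hαβ : 0 < (α + β).re := by
    rw [add_re]
    positivity
  have h0 : α + β ≠ 0 := fun h => by simp [h] at hαβ
  have h1 : ∀ w : PhaseSpace d, gaussianKernel α w * gaussianKernel β (w' - w) *
      Complex.exp (I / 2 * symplectic w w') =
      gaussianKernel β w' * Complex.exp (-(α + β) * ∑ i, ((w i : ℝ) : ℂ) ^ 2 +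
        ∑ i, (2 * β * (w' i : ℂ) + -(I / 2) * (symplecticRot w' i : ℂ)) * ((w i : ℝ) : ℂ)) := by
    intro w
    have hσ : symplectic w w' = ∑ i, -(symplecticRot w' i * w i) := by
      rw [symplectic_swap w', symplectic, Finset.sum_neg_distrib]
    simp only [gaussianKernel, ← Complex.exp_add, ofReal_norm_sq, hσ]
    congr 1
    push_cast
    simp only [PiLp.sub_apply, ofReal_sub, Finset.mul_sum, ← Finset.sum_add_distrib]
    exact Finset.sum_congr rfl fun i _ => by ring
  simp only [h1]
  have h2 : ∑ i, (2 * β * (w' i : ℂ) + -(I / 2) * (symplecticRot w' i : ℂ)) ^ 2 =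
      (4 * β ^ 2 - 1 / 4) * ((‖w'‖ : ℝ) : ℂ) ^ 2 := by
    rw [sum_sq_add_symplecticRot]
    linear_combination (1 / 4 * ((‖w'‖ : ℝ) : ℂ) ^ 2) * I_sq
  have h3 := (EuclideanSpace.volume_preserving_symm_measurableEquiv_toLp
    (Fin d ⊕ Fin d)).integral_comp'
      (g := fun v : Fin d ⊕ Fin d → ℝ => Complex.exp (-(α + β) * ∑ i, ((v i : ℝ) : ℂ) ^ 2 +
        ∑ i, (2 * β * (w' i : ℂ) + -(I / 2) * (symplecticRot w' i : ℂ)) * ((v i : ℝ) : ℂ)))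
  rw [GaussianFourier.integral_cexp_neg_mul_sum_add hαβ, h2] at h3
  rw [integral_const_mul]
  refine (congrArg (gaussianKernel β w' * ·) h3).trans ?_
  simp only [Fintype.card_sum, Fintype.card_fin]
  rw [show (((d + d : ℕ) : ℂ) / 2) = (d : ℂ) by push_cast; ring, cpow_natCast, mul_left_comm]
  congr 1
  simp only [gaussianKernel, ← Complex.exp_add]
  congr 1
  field_simp
  ring

end Gaussian

namespace WeylPair

variable {d : ℕ} {X : Type*} [NormedAddCommGroup X] [NormedSpace ℂ X] (W : WeylPair d X)

theorem weylOp_gaussianKernel_mul [CompleteSpace X] {α β : ℂ} (hα : 0 < α.re) (hβ : 0 < β.re)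
    (hγ : 0 < ((α * β + 1 / 16) / (α + β)).re) :
    W.weylOp (gaussianKernel α) * W.weylOp (gaussianKernel β) =
      (Real.pi / (α + β)) ^ d • W.weylOp (gaussianKernel ((α * β + 1 / 16) / (α + β))) := by
  rw [W.weylOp_mul (isRapidlyDecaying_gaussianKernel hα).integrable
    (isRapidlyDecaying_gaussianKernel hβ).integrable,
    ← W.weylOp_const_mul (isRapidlyDecaying_gaussianKernel hγ).integrable]
  simp only [integral_gaussianKernel_twisted hα hβ]

/-- The Gaussian operators depend holomorphically on the parameter, in the operator norm. -/
theorem hasDerivAt_weylOp_gaussianKernel {α : ℂ} (hα : 0 < α.re) :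
    HasDerivAt (fun β => W.weylOp (gaussianKernel β))
      (W.weylOp fun w => -((‖w‖ : ℝ) : ℂ) ^ 2 * gaussianKernel α w) α := by
  obtain ⟨M, hM⟩ := W.norm_weylExp_le
  have hM0 := (norm_nonneg _).trans (hM 0)
  have hg : ∀ {β : ℂ}, 0 < β.re → Integrable (gaussianKernel β : PhaseSpace d → ℂ) := fun h =>
    (isRapidlyDecaying_gaussianKernel h).integrable
  have hg2 : Integrable fun w : PhaseSpace d => -((‖w‖ : ℝ) : ℂ) ^ 2 * gaussianKernel α w :=
    ((isRapidlyDecaying_gaussianKernel hα).mul_of_norm_le (by fun_prop) (K := 1) 2 fun w => by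
      rw [norm_neg, norm_pow, norm_real, norm_norm, one_mul]
      gcongr
      linarith).integrable
  have hg4 : Integrable fun w : PhaseSpace d => ‖w‖ ^ 4 * Real.exp (-(α.re / 2) * ‖w‖ ^ 2) := by
    have := ((isRapidlyDecaying_gaussianKernel (d := d) (α := α / 2)
      (by simpa using hα)).mul_of_norm_le
      (p := fun w => ((‖w‖ : ℝ) : ℂ) ^ 4) (by fun_prop) (K := 1) 4 fun w => by
        rw [norm_pow, norm_real, norm_norm, one_mul]
        gcongr
        linarith).integrable.norm
    refine this.congr (Eventually.of_forall fun w => ?_)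
    simp only [norm_mul, norm_gaussianKernel, norm_pow, norm_real, norm_norm]
    simp
  -- the kernels satisfy a second order Taylor estimate in `L¹`, as `‖w‖⁴ exp (-(Re α / 2) ‖w‖²)`
  -- is integrable
  rw [hasDerivAt_iff_isLittleO]
  refine Asymptotics.IsBigO.trans_isLittleO ?_ (Asymptotics.isLittleO_pow_sub_sub α one_lt_two)
  refine Asymptotics.IsBigO.of_bound
    (M * ∫ w : PhaseSpace d, ‖w‖ ^ 4 * Real.exp (-(α.re / 2) * ‖w‖ ^ 2)) ?_
  filter_upwards [Metric.ball_mem_nhds α (half_pos hα)] with β hβ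
  have hδ : ‖β - α‖ < α.re / 2 := mem_ball_iff_norm.1 hβ
  have hβ0 : 0 < β.re := by
    have := (abs_re_le_norm (β - α)).trans_lt hδ
    rw [sub_re, abs_lt] at this
    linarith [this.1]
  have hg3 : Integrable fun w : PhaseSpace d => (-1) * gaussianKernel α w +
      (-(β - α)) * (-((‖w‖ : ℝ) : ℂ) ^ 2 * gaussianKernel α w) :=
    ((hg hα).const_mul _).add (hg2.const_mul _)
  have hdiff : W.weylOp (gaussianKernel β) - W.weylOp (gaussianKernel α) -
      (β - α) • W.weylOp (fun w => -((‖w‖ : ℝ) : ℂ) ^ 2 * gaussianKernel α w) =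
      W.weylOp fun w => gaussianKernel β w + ((-1) * gaussianKernel α w +
        (-(β - α)) * (-((‖w‖ : ℝ) : ℂ) ^ 2 * gaussianKernel α w)) := by
    rw [W.weylOp_add (hg hβ0) hg3,
      W.weylOp_add ((hg hα).const_mul _) (hg2.const_mul _), W.weylOp_const_mul (hg hα),
      W.weylOp_const_mul hg2]
    module
  have hint : Integrable fun w : PhaseSpace d => gaussianKernel β w +
      ((-1) * gaussianKernel α w +
        (-(β - α)) * (-((‖w‖ : ℝ) : ℂ) ^ 2 * gaussianKernel α w)) := (hg hβ0).add hg3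
  rw [hdiff, norm_pow, norm_norm, mul_assoc, ← integral_mul_const]
  refine (W.norm_weylOp_le hM hint).trans ?_
  gcongr with w
  · exact hint.norm
  · exact hg4.mul_const _
  · intro w
    have h1 : gaussianKernel β w + ((-1) * gaussianKernel α w +
        (-(β - α)) * (-((‖w‖ : ℝ) : ℂ) ^ 2 * gaussianKernel α w)) = gaussianKernel α w *
        (Complex.exp (-(β - α) * ((‖w‖ : ℝ) : ℂ) ^ 2) - ∑ m ∈ Finset.range 2,
          (-(β - α) * ((‖w‖ : ℝ) : ℂ) ^ 2) ^ m / (m.factorial : ℂ)) := by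
      have : gaussianKernel β w =
          gaussianKernel α w * Complex.exp (-(β - α) * ((‖w‖ : ℝ) : ℂ) ^ 2) := by
        simp only [gaussianKernel, ← Complex.exp_add]
        congr 1
        ring
      rw [this]
      simp [Finset.sum_range_succ]
      ring
    have h2 := norm_exp_sub_sum_le_norm_mul_exp (-(β - α) * ((‖w‖ : ℝ) : ℂ) ^ 2) 2
    have h3 : ‖-(β - α) * ((‖w‖ : ℝ) : ℂ) ^ 2‖ = ‖β - α‖ * ‖w‖ ^ 2 := by
      rw [norm_mul, norm_neg, norm_pow, norm_real, norm_norm]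
    rw [h3] at h2
    simp only [h1]
    rw [norm_mul, norm_gaussianKernel]
    calc _ ≤ Real.exp (-α.re * ‖w‖ ^ 2) *
          ((‖β - α‖ * ‖w‖ ^ 2) ^ 2 * Real.exp (‖β - α‖ * ‖w‖ ^ 2)) := by gcongr
      _ ≤ Real.exp (-α.re * ‖w‖ ^ 2) *
          ((‖β - α‖ * ‖w‖ ^ 2) ^ 2 * Real.exp (α.re / 2 * ‖w‖ ^ 2)) := by gcongr
      _ = ‖w‖ ^ 4 * (Real.exp (-α.re * ‖w‖ ^ 2) * Real.exp (α.re / 2 * ‖w‖ ^ 2)) *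
          ‖β - α‖ ^ 2 := by ring
      _ = _ := by
          rw [← Real.exp_add]
          congr 3
          ring

theorem norm_weylOp_gaussianKernel_apply_sub_le {α : ℂ} (hα : 0 < α.re) (f : X) [CompleteSpace X] :
    ‖W.weylOp (gaussianKernel α) f - ((Real.pi / α) ^ d : ℂ) • f‖ ≤
      ∫ w : PhaseSpace d, Real.exp (-α.re * ‖w‖ ^ 2) * ‖W.weylExp w f - f‖ := by
  have hg := (isRapidlyDecaying_gaussianKernel (d := d) hα).integrable
  rw [W.weylOp_apply hg, ← integral_gaussianKernel hα, ← integral_smul_const,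
    ← integral_sub (W.integrable_smul_weylExp hg f) (hg.smul_const f)]
  refine (norm_integral_le_integral_norm _).trans_eq ?_
  refine integral_congr_ae (Eventually.of_forall fun w => ?_)
  simp only [← smul_sub, norm_smul, norm_gaussianKernel]

/-- The Gaussians `(ρ / π)^d exp (-ρ ‖w‖²)` concentrate at the origin as `ρ → ∞`. -/
theorem tendsto_integral_gaussian_norm_sub (f : X) :
    Tendsto (fun ρ : ℝ => (ρ / Real.pi) ^ d *
      ∫ w : PhaseSpace d, Real.exp (-ρ * ‖w‖ ^ 2) * ‖W.weylExp w f - f‖) atTop (𝓝 0) := by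
  obtain ⟨M, hM⟩ := W.norm_weylExp_le
  have hc := W.continuous_weylExp_apply f
  have h1 : Tendsto (fun ρ : ℝ => ∫ w : PhaseSpace d, Real.exp (-1 * ‖w‖ ^ 2) *
      ‖W.weylExp ((√ρ)⁻¹ • w) f - f‖) atTop
      (𝓝 (∫ w : PhaseSpace d, Real.exp (-1 * ‖w‖ ^ 2) * ‖W.weylExp ((0 : ℝ) • w) f - f‖)) := by
    have hs : Tendsto (fun ρ : ℝ => (√ρ)⁻¹) atTop (𝓝 0) :=
      tendsto_inv_atTop_zero.comp Real.tendsto_sqrt_atTop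
    refine tendsto_integral_filter_of_dominated_convergence
      (fun w => Real.exp (-1 * ‖w‖ ^ 2) * (M * ‖f‖ + ‖f‖))
      (Eventually.of_forall fun ρ => ?_) (Eventually.of_forall fun ρ => ?_) ?_ ?_
    · exact Continuous.aestronglyMeasurable (by fun_prop)
    · refine Eventually.of_forall fun w => ?_
      rw [norm_mul, norm_norm, Real.norm_eq_abs, Real.abs_exp]
      gcongr
      refine (norm_sub_le _ _).trans ?_
      gcongr
      exact ((W.weylExp _).le_opNorm f).trans (by gcongr; exact hM _)
    · have := (isRapidlyDecaying_gaussianKernel (d := d) (α := 1) (by simp)).integrable.norm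
      simp only [norm_gaussianKernel, one_re] at this
      exact this.mul_const _
    · refine Eventually.of_forall fun w => Tendsto.const_mul _ ?_
      have hcont : Continuous fun r : ℝ => ‖W.weylExp (r • w) f - f‖ := by fun_prop
      exact (hcont.tendsto 0).comp hs
  simp only [zero_smul, weylExp_zero, one_apply_eq_self, sub_self, norm_zero, mul_zero,
    integral_zero] at h1
  have h2 := h1.const_mul ((1 / Real.pi) ^ d)
  rw [mul_zero] at h2
  refine h2.congr' ?_
  filter_upwards [eventually_gt_atTop 0] with ρ hρ
  have hρ' : 0 < √ρ := Real.sqrt_pos.2 hρ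
  have h3 := Measure.integral_comp_smul (volume : Measure (PhaseSpace d))
    (fun w => Real.exp (-ρ * ‖w‖ ^ 2) * ‖W.weylExp w f - f‖) (√ρ)⁻¹
  have h4 : |(((√ρ)⁻¹ ^ Module.finrank ℝ (PhaseSpace d))⁻¹)| = ρ ^ d := by
    simp only [finrank_euclideanSpace, Fintype.card_sum, Fintype.card_fin]
    rw [inv_pow, inv_inv, abs_of_pos (by positivity), ← two_mul, pow_mul, Real.sq_sqrt hρ.le]
  rw [h4] at h3
  rw [div_pow, div_pow, one_pow, div_mul_eq_mul_div, div_mul_eq_mul_div, one_mul,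
    ← smul_eq_mul (ρ ^ d), ← h3]
  congr 1
  refine integral_congr_ae (Eventually.of_forall fun w => ?_)
  simp only
  congr 2
  rw [norm_smul, mul_pow, norm_inv, inv_pow, Real.norm_eq_abs, sq_abs, Real.sq_sqrt hρ.le]
  field_simp

end WeylPair

/-! ### The squares of `A_j` and `B_j` acting on Gaussian kernels -/

section LinearPMapSum

variable {X : Type*} [NormedAddCommGroup X] [NormedSpace ℂ X]

theorem mem_graph_add {S T : X →ₗ.[ℂ] X} {f g h : X} (hS : (f, g) ∈ S.graph)
    (hT : (f, h) ∈ T.graph) : (f, g + h) ∈ (S + T).graph := by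
  obtain ⟨y, h0, hy⟩ := (LinearPMap.mem_graph_iff _).1 hS
  obtain ⟨y', h1, hy'⟩ := (LinearPMap.mem_graph_iff _).1 hT
  simp only at h0 hy h1 hy'
  subst h0 hy hy'
  have hmem : (y : X) ∈ T.domain := h1 ▸ y'.2
  refine (LinearPMap.mem_graph_iff _).2 ⟨⟨y, y.2, hmem⟩, rfl, ?_⟩
  rw [LinearPMap.add_apply]
  congr 2
  exact Subtype.ext h1.symm

theorem mem_graph_sum {ι : Type*} (s : Finset ι) {S : ι → X →ₗ.[ℂ] X} {f : X} {h : ι → X}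
    (hS : ∀ i ∈ s, (f, h i) ∈ (S i).graph) : (f, ∑ i ∈ s, h i) ∈ (∑ i ∈ s, S i).graph := by
  classical
  induction s using Finset.induction_on with
  | empty =>
    simp only [Finset.sum_empty]
    exact (LinearPMap.mem_graph_iff _).2 ⟨⟨f, trivial⟩, rfl, rfl⟩
  | insert a s ha ih =>
    rw [Finset.sum_insert ha, Finset.sum_insert ha]
    exact mem_graph_add (hS a (Finset.mem_insert_self a s))
      (ih fun i hi => hS i (Finset.mem_insert_of_mem hi))

end LinearPMapSum

section LadderForm

variable {d : ℕ}

/-- The linear form `ℓ` for which `-∂_i + (i c / 2) (J w)_i` maps `exp (-α ‖w‖²)` to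
`ℓ(w) exp (-α ‖w‖²)`. -/
noncomputable def ladderForm (α : ℂ) (c : ℝ) (i : Fin d ⊕ Fin d) (w : PhaseSpace d) : ℂ :=
  2 * α * (w i : ℂ) + I / 2 * c * (symplecticRot w i : ℂ)

theorem ladderForm_add_smul_single (α : ℂ) (c : ℝ) (i : Fin d ⊕ Fin d) (w : PhaseSpace d) (s : ℝ) :
    ladderForm α c i (w + s • EuclideanSpace.single i 1) = ladderForm α c i w + s * (2 * α) := by
  cases i <;> simp [ladderForm, symplecticRot] <;> ring

theorem sum_ladderForm_sq (α : ℂ) {c : ℝ} (hc : c ^ 2 = 1) (w : PhaseSpace d) :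
    ∑ i, ladderForm α c i w ^ 2 = (4 * α ^ 2 - 1 / 4) * ((‖w‖ : ℝ) : ℂ) ^ 2 := by
  have hc' : (c : ℂ) ^ 2 = 1 := by exact_mod_cast hc
  simp only [ladderForm]
  rw [sum_sq_add_symplecticRot]
  linear_combination (1 / 4 * ((‖w‖ : ℝ) : ℂ) ^ 2) * (c ^ 2 * I_sq - hc')

theorem isRapidlyDecaying_ladderForm_pow_mul {α : ℂ} (hα : 0 < α.re) (c : ℝ) (i : Fin d ⊕ Fin d)
    (n : ℕ) : IsRapidlyDecaying fun w => ladderForm α c i w ^ n * gaussianKernel α w := by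
  have hJ := continuous_symplecticRot (d := d) i
  refine (isRapidlyDecaying_gaussianKernel hα).mul_of_norm_le (by unfold ladderForm; fun_prop)
    (K := (2 * ‖α‖ + 1 / 2 * |c|) ^ n) n fun w => ?_
  rw [norm_pow, ← mul_pow]
  gcongr
  have h1 : ‖(w i : ℂ)‖ ≤ 1 + ‖w‖ := by
    rw [norm_real]
    linarith [PiLp.norm_apply_le w i]
  have h2 : ‖(symplecticRot w i : ℂ)‖ ≤ 1 + ‖w‖ := by
    rw [norm_real]
    linarith [abs_symplecticRot_le w i, Real.norm_eq_abs (symplecticRot w i)]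
  refine (norm_add_le _ _).trans ?_
  simp only [norm_mul, norm_div, norm_I, norm_real, Real.norm_eq_abs, Complex.norm_ofNat]
  rw [add_mul]
  gcongr
  · simpa using h1
  · simpa using h2

theorem hasDerivAt_mul_gaussianKernel {α : ℂ} {i : Fin d ⊕ Fin d} {p : PhaseSpace d → ℂ} {p' : ℂ}
    (hp : ∀ w (s : ℝ), p (w + s • EuclideanSpace.single i 1) = p w + s * p') (w : PhaseSpace d) :
    HasDerivAt (fun s : ℝ => p (w + s • EuclideanSpace.single i 1) *
        gaussianKernel α (w + s • EuclideanSpace.single i 1))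
      ((p' - 2 * α * (w i : ℂ) * p w) * gaussianKernel α w) 0 := by
  have hnorm : ∀ s : ℝ, ((‖w + s • EuclideanSpace.single i (1 : ℝ)‖ : ℝ) : ℂ) ^ 2 =
      ((‖w‖ : ℝ) : ℂ) ^ 2 + 2 * (s * (w i : ℂ)) + (s : ℂ) ^ 2 := by
    intro s
    have := norm_add_sq_real w (s • EuclideanSpace.single i (1 : ℝ))
    rw [norm_smul, mul_pow, Real.norm_eq_abs, sq_abs, inner_smul_right] at this
    simp only [EuclideanSpace.inner_single_right, PiLp.norm_single] at this
    simp at this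
    exact_mod_cast this
  simp only [hp, gaussianKernel, hnorm]
  have hs : HasDerivAt (fun s : ℝ => (s : ℂ)) 1 0 := Complex.ofRealCLM.hasDerivAt
  have h1 : HasDerivAt (fun s : ℝ => p w + s * p') (1 * p') 0 := (hs.mul_const p').const_add _
  have h2 := (((((hs.mul_const (w i : ℂ)).const_mul 2).const_add (((‖w‖ : ℝ) : ℂ) ^ 2)).add
    (hs.pow 2)).const_mul (-α)).cexp
  refine (h1.mul h2).congr_deriv ?_
  simp
  ring

end LadderForm

namespace WeylPair

variable {d : ℕ} {X : Type*} [NormedAddCommGroup X] [NormedSpace ℂ X] (W : WeylPair d X)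

theorem weylOp_mul_gaussianKernel_apply {α : ℂ} {i : Fin d ⊕ Fin d} {p : PhaseSpace d → ℂ} {p' : ℂ}
    (hp : ∀ w (s : ℝ), p (w + s • EuclideanSpace.single i 1) = p w + s * p')
    (h0 : IsRapidlyDecaying fun w => p w * gaussianKernel α w)
    (h1 : IsRapidlyDecaying fun w => (ladderForm α 1 i w * p w - p') * gaussianKernel α w)
    {f g : X} (hfg : (f, g) ∈ (W.op i).graph) :
    W.weylOp (fun w => p w * gaussianKernel α w) (I • g) =
      W.weylOp (fun w => (ladderForm α 1 i w * p w - p') * gaussianKernel α w) f := by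
  have h2 : (fun w => (ladderForm α 1 i w * p w - p') * gaussianKernel α w) = fun w =>
      -((p' - 2 * α * (w i : ℂ) * p w) * gaussianKernel α w) +
        I / 2 * (1 : ℝ) * symplecticRot w i * (p w * gaussianKernel α w) := by
    funext w
    simp only [ladderForm]
    ring
  rw [h2] at h1 ⊢
  exact W.weylOp_apply_of_mem_graph hfg h0 h1 (hasDerivAt_mul_gaussianKernel hp)

theorem weylOp_mul_gaussianKernel_mem_graph [CompleteSpace X] {α : ℂ} {i : Fin d ⊕ Fin d}
    {p : PhaseSpace d → ℂ} {p' : ℂ}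
    (hp : ∀ w (s : ℝ), p (w + s • EuclideanSpace.single i 1) = p w + s * p')
    (h0 : IsRapidlyDecaying fun w => p w * gaussianKernel α w)
    (h1 : IsRapidlyDecaying fun w => (ladderForm α (-1) i w * p w - p') * gaussianKernel α w)
    (f : X) :
    (W.weylOp (fun w => p w * gaussianKernel α w) f,
      -(I • W.weylOp (fun w => (ladderForm α (-1) i w * p w - p') * gaussianKernel α w) f)) ∈
        (W.op i).graph := by
  have h2 : (fun w => (ladderForm α (-1) i w * p w - p') * gaussianKernel α w) = fun w =>
      -((p' - 2 * α * (w i : ℂ) * p w) * gaussianKernel α w) +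
        I / 2 * (-1 : ℝ) * symplecticRot w i * (p w * gaussianKernel α w) := by
    funext w
    simp only [ladderForm]
    ring
  rw [h2] at h1 ⊢
  exact W.weylOp_apply_mem_graph h0 h1 (hasDerivAt_mul_gaussianKernel hp) f

theorem isRapidlyDecaying_ladderForm_sq_sub {α : ℂ} (hα : 0 < α.re) (c : ℝ) (i : Fin d ⊕ Fin d) :
    IsRapidlyDecaying fun w => (ladderForm α c i w ^ 2 - 2 * α) * gaussianKernel α w := by
  convert (isRapidlyDecaying_ladderForm_pow_mul hα c i 2).add
    ((isRapidlyDecaying_gaussianKernel hα).const_mul (-(2 * α))) using 2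
  ring

/-- Two integrations by parts: a Gaussian operator applied to `A_j² f` or `B_j² f`. -/
theorem weylOp_gaussianKernel_apply_sq {α : ℂ} (hα : 0 < α.re) {i : Fin d ⊕ Fin d} {f h : X}
    (hfh : (f, h) ∈ (unboundedSq (W.op i)).graph) : W.weylOp (gaussianKernel α) h =
      -W.weylOp (fun w => (ladderForm α 1 i w ^ 2 - 2 * α) * gaussianKernel α w) f := by
  obtain ⟨g, hfg, hgh⟩ := mem_graph_unboundedSq.1 hfh
  have r0 := isRapidlyDecaying_gaussianKernel (d := d) hα
  have r1 := isRapidlyDecaying_ladderForm_pow_mul hα 1 i 1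
  have r2 := isRapidlyDecaying_ladderForm_sq_sub hα 1 i
  simp only [pow_one] at r1
  have h1 := W.weylOp_mul_gaussianKernel_apply (α := α) (p := fun _ => 1) (p' := 0) (by simp)
    (by simpa using r0) (by simpa using r1) hgh
  have h2 := W.weylOp_mul_gaussianKernel_apply (α := α) (p := ladderForm α 1 i) (p' := 2 * α)
    (ladderForm_add_smul_single α 1 i) r1 (by simpa only [← sq] using r2) hfg
  simp only [one_mul, mul_one, sub_zero, ← sq] at h1 h2
  rw [← h2, map_smul, ← h1, map_smul, smul_smul, I_mul_I, neg_one_smul, neg_neg]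

/-- Gaussian operators map into the domains of all `A_j²` and `B_j²`. -/
theorem weylOp_gaussianKernel_apply_mem [CompleteSpace X] {α : ℂ} (hα : 0 < α.re)
    (i : Fin d ⊕ Fin d) (f : X) :
    W.weylOp (gaussianKernel α) f ∈ (unboundedSq (W.op i)).domain := by
  have r0 := isRapidlyDecaying_gaussianKernel (d := d) hα
  have r1 := isRapidlyDecaying_ladderForm_pow_mul hα (-1) i 1
  have r2 := isRapidlyDecaying_ladderForm_sq_sub hα (-1) i
  simp only [pow_one] at r1
  have h1 := W.weylOp_mul_gaussianKernel_mem_graph (α := α) (i := i) (p := fun _ => 1) (p' := 0)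
    (by simp) (by simpa using r0) (by simpa using r1) f
  have h2 := W.weylOp_mul_gaussianKernel_mem_graph (α := α) (p := ladderForm α (-1) i)
    (p' := 2 * α) (ladderForm_add_smul_single α (-1) i) r1 (by simpa only [← sq] using r2) f
  simp only [one_mul, mul_one, sub_zero] at h1
  have h3 := (W.op i).graph.smul_mem (-I) h2
  rw [Prod.smul_mk, neg_smul] at h3
  exact LinearPMap.mem_domain_of_mem_graph (mem_graph_unboundedSq.2 ⟨_, h1, h3⟩)

theorem mem_domain_sqA_add_sqB {f : X} : f ∈ (W.sqA + W.sqB).domain ↔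
    ∀ i, f ∈ (unboundedSq (W.op i)).domain := by
  rw [LinearPMap.add_domain, Submodule.mem_inf, sqA, sqB, mem_domain_sum, mem_domain_sum]
  simp [op]

theorem exists_graph_sqA_add_sqB {f : X} (hf : f ∈ (W.sqA + W.sqB).domain) :
    ∃ h : Fin d ⊕ Fin d → X, (∀ i, (f, h i) ∈ (unboundedSq (W.op i)).graph) ∧
      (W.sqA + W.sqB) ⟨f, hf⟩ = ∑ i, h i := by
  have h1 := W.mem_domain_sqA_add_sqB.1 hf
  refine ⟨fun i => unboundedSq (W.op i) ⟨f, h1 i⟩,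
    fun i => (unboundedSq (W.op i)).mem_graph ⟨f, h1 i⟩, ?_⟩
  have h2 : (f, ∑ i, unboundedSq (W.op i) ⟨f, h1 i⟩) ∈ (W.sqA + W.sqB).graph := by
    rw [Fintype.sum_sum_type]
    exact mem_graph_add
      (mem_graph_sum _ fun j _ => (unboundedSq (W.op (Sum.inl j))).mem_graph ⟨f, h1 (Sum.inl j)⟩)
      (mem_graph_sum _ fun j _ => (unboundedSq (W.op (Sum.inr j))).mem_graph ⟨f, h1 (Sum.inr j)⟩)
  exact LinearPMap.mem_graph_snd_inj _ ((W.sqA + W.sqB).mem_graph ⟨f, hf⟩) h2 rfl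

/-- A Gaussian operator applied to `(A² + B²) f`, in terms of Gaussian kernels. -/
theorem weylOp_gaussianKernel_apply_sqA_add_sqB {α : ℂ} (hα : 0 < α.re) {f : X}
    (hf : f ∈ (W.sqA + W.sqB).domain) :
    W.weylOp (gaussianKernel α) ((W.sqA + W.sqB) ⟨f, hf⟩) =
      (4 * α ^ 2 - 1 / 4) • W.weylOp (fun w => -((‖w‖ : ℝ) : ℂ) ^ 2 * gaussianKernel α w) f +
        (4 * α * d) • W.weylOp (gaussianKernel α) f := by
  obtain ⟨h, hh, hsum⟩ := W.exists_graph_sqA_add_sqB hf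
  have r0 := isRapidlyDecaying_gaussianKernel (d := d) hα
  have r2 : IsRapidlyDecaying fun w : PhaseSpace d => -((‖w‖ : ℝ) : ℂ) ^ 2 * gaussianKernel α w :=
    (isRapidlyDecaying_gaussianKernel hα).mul_of_norm_le (by fun_prop) (K := 1) 2 fun w => by
      rw [norm_neg, norm_pow, norm_real, norm_norm, one_mul]
      gcongr
      linarith
  rw [hsum, map_sum]
  simp only [W.weylOp_gaussianKernel_apply_sq hα (hh _)]
  rw [Finset.sum_neg_distrib, ← sum_apply, ← W.weylOp_sum _ fun i _ =>
    (isRapidlyDecaying_ladderForm_sq_sub hα 1 i).integrable]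
  have h1 : (fun w : PhaseSpace d => ∑ i, (ladderForm α 1 i w ^ 2 - 2 * α) * gaussianKernel α w) =
      fun w => (-(4 * α ^ 2 - 1 / 4)) * (-((‖w‖ : ℝ) : ℂ) ^ 2 * gaussianKernel α w) +
        (-(4 * α * d)) * gaussianKernel α w := by
    funext w
    rw [← Finset.sum_mul, Finset.sum_sub_distrib, sum_ladderForm_sq α (by norm_num)]
    simp
    ring
  rw [h1, W.weylOp_add (r2.integrable.const_mul _) (r0.integrable.const_mul _),
    W.weylOp_const_mul r2.integrable, W.weylOp_const_mul r0.integrable]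
  simp only [add_apply, smul_apply]
  module

end WeylPair

/-! ### Generators of differentiable semigroups -/

section Generator

variable {X : Type*} [NormedAddCommGroup X] [NormedSpace ℂ X]

/-- For a semigroup that is differentiable at positive times, the generator is described by
conditions at positive times only, which are stable under limits in the graph norm. -/
theorem mem_graph_generator_iff_of_hasDerivAt {T T' : ℝ → X →L[ℂ] X} (hT : IsC0Semigroup T)
    (hd : ∀ t, 0 < t → HasDerivAt T (T' t) t) {f g : X} :
    (f, g) ∈ (generator (𝓝[>] (0 : ℝ)) T).graph ↔ ∀ t, 0 < t → T' t f = T t g := by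
  have hda : ∀ t, 0 < t → HasDerivAt (fun s => T s f) (T' t f) t := fun t ht => by
    have h := (ContinuousLinearMap.apply ℂ X f).restrictScalars ℝ |>.hasFDerivAt.comp_hasDerivAt t
      (hd t ht)
    exact h
  have hgr : (f, g) ∈ (generator (𝓝[>] (0 : ℝ)) T).graph ↔
      HasDerivWithinAt (fun s => T s f) g (Ioi 0) 0 := by
    rw [mem_graph_generator, hasDerivWithinAt_iff_tendsto_slope' self_notMem_Ioi]
    refine tendsto_congr fun t => ?_
    rw [slope_def_module, sub_zero, hT.map_zero, one_apply_eq_self, ← ofReal_inv, Complex.coe_smul]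
  rw [hgr]
  constructor
  · intro h t ht
    -- the semigroup law carries the right derivative at `0` to a right derivative at `t`
    have h1 : HasDerivWithinAt (fun s => T t (T s f)) (T t g) (Ioi 0) 0 :=
      ((T t).restrictScalars ℝ).hasFDerivAt.comp_hasDerivWithinAt _ h
    have h2 : HasDerivWithinAt (fun s => T (t + s) f) (T t g) (Ioi 0) 0 := by
      refine h1.congr (fun s hs => ?_) ?_
      · rw [hT.map_add t s ht.le (le_of_lt hs)]
        rfl
      · rw [hT.map_add t 0 ht.le le_rfl]
        rfl
    have h3 : HasDerivAt (fun s => T (t + s) f) (T' t f) 0 := by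
      have := hda t ht
      rw [← add_zero t] at this
      simpa using this.comp_const_add t 0
    exact (uniqueDiffWithinAt_Ioi (0 : ℝ)).eq_deriv _ h3.hasDerivWithinAt h2
  · intro h
    have hc : ∀ f', Tendsto (fun s => T s f') (𝓝[>] 0) (𝓝 f') := fun f' => by
      have := (hT.continuousOn_apply f' 0 self_mem_Ici).tendsto
      rw [hT.map_zero] at this
      exact this.mono_left (nhdsWithin_mono _ Ioi_subset_Ici_self)
    refine (hasDerivWithinAt_Ici_of_tendsto_deriv (s := Ioi 0) (f := fun s => T s f) (e := g)
      (fun t ht => (hda t ht).differentiableAt.differentiableWithinAt) ?_ self_mem_nhdsWithin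
      ?_).mono Ioi_subset_Ici_self
    · have := hc f
      rw [ContinuousWithinAt, hT.map_zero]
      exact this
    · refine (hc g).congr' ?_
      filter_upwards [self_mem_nhdsWithin] with t ht
      rw [(hda t ht).deriv, h t ht]

/-- For a semigroup that is differentiable at positive times, a subspace of the domain of the
generator into which the semigroup maps at positive times is a core. -/
theorem hasCore_generator {T T' : ℝ → X →L[ℂ] X} (hT : IsC0Semigroup T)
    (hd : ∀ t, 0 < t → HasDerivAt T (T' t) t) {D : Submodule ℂ X}
    (hD : D ≤ (generator (𝓝[>] (0 : ℝ)) T).domain) (hTD : ∀ t, 0 < t → ∀ f, T t f ∈ D) :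
    (generator (𝓝[>] (0 : ℝ)) T).HasCore D := by
  -- the description of the graph at positive times shows that the generator is closed
  have hcl : (generator (𝓝[>] (0 : ℝ)) T).IsClosed := by
    have : ((generator (𝓝[>] (0 : ℝ)) T).graph : Set (X × X)) =
        ⋂ (t : ℝ) (_ : 0 < t), {p | T' t p.1 = T t p.2} := by
      ext ⟨f, g⟩
      rw [SetLike.mem_coe, mem_graph_generator_iff_of_hasDerivAt hT hd]
      simp
    rw [LinearPMap.IsClosed, this]
    exact isClosed_iInter fun t => isClosed_iInter fun _ =>
      isClosed_eq (by fun_prop) (by fun_prop)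
  have hle : (generator (𝓝[>] (0 : ℝ)) T).domRestrict D ≤ generator (𝓝[>] (0 : ℝ)) T :=
    LinearPMap.domRestrict_le
  have hclos : ((generator (𝓝[>] (0 : ℝ)) T).domRestrict D).IsClosable :=
    hcl.isClosable.leIsClosable hle
  refine ⟨hD, LinearPMap.eq_of_eq_graph ?_⟩
  rw [← hclos.graph_closure_eq_closure_graph]
  refine le_antisymm (Submodule.topologicalClosure_minimal _ (LinearPMap.le_graph_of_le hle) hcl) ?_
  rintro ⟨f, g⟩ hfg
  have hc : ∀ f', Tendsto (fun s => T s f') (𝓝[>] 0) (𝓝 f') := fun f' => by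
    have := (hT.continuousOn_apply f' 0 self_mem_Ici).tendsto
    rw [hT.map_zero] at this
    exact this.mono_left (nhdsWithin_mono _ Ioi_subset_Ici_self)
  -- `(T t f, T t g)` lies in the graph of the restriction to `D` and tends to `(f, g)`
  refine mem_closure_of_tendsto ((hc f).prodMk_nhds (hc g)) ?_
  filter_upwards [self_mem_nhdsWithin] with t ht
  have h1 : (T t f, T t g) ∈ (generator (𝓝[>] (0 : ℝ)) T).graph := by
    rw [mem_graph_generator] at hfg ⊢
    refine (((T t).continuous.tendsto g).comp hfg).congr' ?_
    filter_upwards [self_mem_nhdsWithin] with s hs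
    have : T t (T s f) = T s (T t f) := by
      change (T t * T s) f = (T s * T t) f
      rw [← hT.map_add t s (le_of_lt ht) (le_of_lt hs),
        ← hT.map_add s t (le_of_lt hs) (le_of_lt ht), add_comm]
    simp [this]
  obtain ⟨y, hy, hyg⟩ := (LinearPMap.mem_graph_iff _).1 h1
  refine (LinearPMap.mem_graph_iff _).2 ⟨⟨T t f, hTD t ht f, hD (hTD t ht f)⟩, rfl, ?_⟩
  rw [← hyg]
  exact LinearPMap.domRestrict_apply hy.symm

end Generator

/-! ### The Mehler semigroup in the right half-plane -/

section MehlerCoefficients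

/-- The rate `coth(z / 2) / 4 = (1 + e^{-z}) / (4 (1 - e^{-z}))` of the Gaussian kernel of
`P(z)`. -/
noncomputable def mehlerRate (z : ℂ) : ℂ := (1 + Complex.exp (-z)) / (4 * (1 - Complex.exp (-z)))

/-- The factor `(2π (1 - e^{-z}))^{-d}` in front of the Gaussian kernel of
`P(z)`. -/
noncomputable def mehlerConst (d : ℕ) (z : ℂ) : ℂ :=
  ((2 * Real.pi * (1 - Complex.exp (-z))) ^ d)⁻¹

variable {z w : ℂ}

theorem norm_exp_neg_lt_one (hz : 0 < z.re) : ‖Complex.exp (-z)‖ < 1 := by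
  rw [Complex.norm_exp]
  simpa using hz

theorem one_sub_exp_neg_ne_zero (hz : 0 < z.re) : 1 - Complex.exp (-z) ≠ 0 := by
  intro h
  have := norm_exp_neg_lt_one hz
  rw [← sub_eq_zero.1 h, norm_one] at this
  exact lt_irrefl _ this

theorem mehlerRate_re (z : ℂ) : (mehlerRate z).re =
    (1 - ‖Complex.exp (-z)‖ ^ 2) / (4 * ‖1 - Complex.exp (-z)‖ ^ 2) := by
  have h : mehlerRate z = (1 / 4 : ℝ) * ((1 + Complex.exp (-z)) / (1 - Complex.exp (-z))) := by
    rw [mehlerRate, ← div_div, div_right_comm]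
    push_cast
    ring
  rw [h, re_ofReal_mul, div_re, ← normSq_eq_norm_sq, ← normSq_eq_norm_sq, ← add_div]
  rw [normSq_apply (Complex.exp (-z))]
  simp only [add_re, one_re, sub_re, add_im, one_im, sub_im]
  rw [mul_comm (4 : ℝ), ← div_div]
  ring

theorem mehlerRate_re_pos (hz : 0 < z.re) : 0 < (mehlerRate z).re := by
  have h1 := norm_exp_neg_lt_one hz
  have h2 := norm_pos_iff.2 (one_sub_exp_neg_ne_zero hz)
  rw [mehlerRate_re]
  have : 0 < 1 - ‖Complex.exp (-z)‖ ^ 2 := by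
    nlinarith [norm_nonneg (Complex.exp (-z))]
  positivity

/-- In terms of `coth`, this is the addition theorem, which matches the composition of Gaussian
operators. -/
theorem mehlerRate_add (hz : 0 < z.re) (hw : 0 < w.re) :
    (mehlerRate z * mehlerRate w + 1 / 16) / (mehlerRate z + mehlerRate w) =
      mehlerRate (z + w) := by
  have h1 := one_sub_exp_neg_ne_zero hz
  have h2 := one_sub_exp_neg_ne_zero hw
  have h3 : 1 - Complex.exp (-(z + w)) ≠ 0 := one_sub_exp_neg_ne_zero (by rw [add_re]; positivity)
  have h4 : mehlerRate z + mehlerRate w ≠ 0 := fun h => by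
    have := congrArg re h
    rw [add_re, zero_re] at this
    linarith [mehlerRate_re_pos hz, mehlerRate_re_pos hw]
  rw [div_eq_iff h4]
  unfold mehlerRate
  rw [neg_add, Complex.exp_add] at h3 ⊢
  field_simp
  ring

theorem mehlerConst_mul (d : ℕ) (hz : 0 < z.re) (hw : 0 < w.re) :
    mehlerConst d z * mehlerConst d w * (Real.pi / (mehlerRate z + mehlerRate w)) ^ d =
      mehlerConst d (z + w) := by
  have h1 := one_sub_exp_neg_ne_zero hz
  have h2 := one_sub_exp_neg_ne_zero hw
  have h3 : 1 - Complex.exp (-(z + w)) ≠ 0 := one_sub_exp_neg_ne_zero (by rw [add_re]; positivity)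
  have hpi : (Real.pi : ℂ) ≠ 0 := by exact_mod_cast Real.pi_ne_zero
  rw [neg_add, Complex.exp_add] at h3
  have h4 : mehlerRate z + mehlerRate w = (1 - Complex.exp (-z) * Complex.exp (-w)) /
      (2 * ((1 - Complex.exp (-z)) * (1 - Complex.exp (-w)))) := by
    unfold mehlerRate
    field_simp
    ring
  rw [h4]
  unfold mehlerConst
  rw [neg_add, Complex.exp_add, ← inv_pow, ← inv_pow, ← inv_pow, ← mul_pow, ← mul_pow]
  congr 1
  field_simp

/-- Together with `hasDerivAt_mehlerConst`, this says that the kernel `k` of `P(z)` satisfies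
`∂_z k = Δk / 2 - ‖w‖² k / 8 + (d / 2) k`. -/
theorem hasDerivAt_mehlerRate (hz : 0 < z.re) :
    HasDerivAt mehlerRate (1 / 8 - 2 * mehlerRate z ^ 2) z := by
  have h1 := one_sub_exp_neg_ne_zero hz
  have hq : HasDerivAt (fun z => Complex.exp (-z)) (Complex.exp (-z) * -1) z :=
    (hasDerivAt_neg z).cexp
  refine ((hq.const_add 1).div ((hq.const_sub 1).const_mul 4) (by simpa using h1)).congr_deriv ?_
  unfold mehlerRate
  field_simp
  ring

theorem hasDerivAt_mehlerConst (d : ℕ) (hz : 0 < z.re) : HasDerivAt (mehlerConst d)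
    (mehlerConst d z * (d / 2 - 2 * mehlerRate z * d)) z := by
  have h1 := one_sub_exp_neg_ne_zero hz
  have hpi : (Real.pi : ℂ) ≠ 0 := by exact_mod_cast Real.pi_ne_zero
  have hq : HasDerivAt (fun z => Complex.exp (-z)) (Complex.exp (-z) * -1) z :=
    (hasDerivAt_neg z).cexp
  refine ((((hq.const_sub 1).const_mul (2 * (Real.pi : ℂ))).pow d).fun_inv ?_).congr_deriv ?_
  · simp only [Pi.pow_apply]
    exact pow_ne_zero _ (by simp [h1, hpi])
  · unfold mehlerConst mehlerRate
    rcases d with _ | n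
    · simp
    · simp only [Pi.pow_apply, Nat.add_sub_cancel]
      push_cast
      field_simp
      ring

/-- The estimate behind the uniform bound on sectors: the `d`-th power of the left side is the
`L¹`-norm of the kernel of `P(z)`. -/
theorem norm_one_sub_exp_neg_div_le {θ : ℝ} (hθ : 0 < Real.cos θ) (hz : ‖z‖ * Real.cos θ ≤ z.re)
    (hz0 : 0 < z.re) : 2 * ‖1 - Complex.exp (-z)‖ / (1 - ‖Complex.exp (-z)‖ ^ 2) ≤
      6 / Real.cos θ := by
  have hq := norm_exp_neg_lt_one hz0
  have hden : 0 < 1 - ‖Complex.exp (-z)‖ ^ 2 := by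
    nlinarith [norm_nonneg (Complex.exp (-z))]
  have hsq : ‖Complex.exp (-z)‖ ^ 2 = Real.exp (-(2 * z.re)) := by
    rw [Complex.norm_exp, ← Real.exp_nat_mul]
    congr 1
    simp
  -- `1 - e^{-2x} ≥ 2x / (1 + 2x)` bounds the denominator from below
  have hlow : ∀ c : ℝ, 0 < c → c ≤ 1 → c ≤ z.re → 2 * c / 3 ≤ 1 - ‖Complex.exp (-z)‖ ^ 2 := by
    intro c hc hc1 hcx
    have h1 : Real.exp (-(2 * z.re)) ≤ Real.exp (-(2 * c)) := by gcongr
    have h2 : Real.exp (-(2 * c)) ≤ 1 / (1 + 2 * c) := by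
      rw [Real.exp_neg, ← one_div]
      gcongr
      linarith [Real.add_one_le_exp (2 * c)]
    have h3 : 1 / (1 + 2 * c) ≤ 1 - 2 * c / 3 := by
      rw [div_le_iff₀ (by positivity)]
      nlinarith
    rw [hsq]
    linarith
  rw [div_le_div_iff₀ hden hθ]
  by_cases hz1 : ‖z‖ ≤ 1
  · have h1 : ‖1 - Complex.exp (-z)‖ ≤ 2 * ‖z‖ := by
      rw [norm_sub_rev, ← norm_neg z]
      exact Complex.norm_exp_sub_one_le (by rwa [norm_neg])
    have h2 := hlow z.re hz0 ((Complex.re_le_norm z).trans hz1) le_rfl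
    nlinarith
  · push Not at hz1
    have h1 : ‖1 - Complex.exp (-z)‖ ≤ 2 := by
      refine (norm_sub_le _ _).trans ?_
      rw [norm_one]
      linarith
    have h2 := hlow (Real.cos θ) hθ (Real.cos_le_one θ) (by nlinarith)
    nlinarith

theorem re_pos_of_mem_sector {θ : ℝ} (hθ : θ ≤ Real.pi / 2) (hz : z ∈ sector θ) : 0 < z.re :=
  (abs_arg_lt_pi_div_two_iff.1 (hz.2.trans_le hθ)).resolve_right hz.1

theorem mem_sector_pi_div_two : z ∈ sector (Real.pi / 2) ↔ 0 < z.re := by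
  refine ⟨re_pos_of_mem_sector le_rfl, fun h => ⟨?_, abs_arg_lt_pi_div_two_iff.2 (Or.inl h)⟩⟩
  rintro rfl
  simp at h

theorem ofReal_mem_sector {t θ : ℝ} (ht : 0 < t) (hθ : 0 < θ) : (t : ℂ) ∈ sector θ :=
  ⟨by exact_mod_cast ht.ne', by rwa [arg_ofReal_of_nonneg ht.le, abs_zero]⟩

theorem norm_mul_cos_le_re {θ : ℝ} (hθ : θ ≤ Real.pi / 2) (hz : z ∈ sector θ) :
    ‖z‖ * Real.cos θ ≤ z.re := by
  rw [← Complex.norm_mul_cos_arg z, ← Real.cos_abs z.arg]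
  gcongr
  exact Real.cos_le_cos_of_nonneg_of_le_pi (abs_nonneg _) (by linarith [Real.pi_pos]) hz.2.le

end MehlerCoefficients

namespace WeylPair

variable {d : ℕ} {X : Type*} [NormedAddCommGroup X] [NormedSpace ℂ X] (W : WeylPair d X)

/-- The extension `P(z)` of the semigroup to the right half-plane, and `I` elsewhere. -/
noncomputable def mehlerExt (z : ℂ) : X →L[ℂ] X :=
  if 0 < z.re then mehlerConst d z • W.weylOp (gaussianKernel (mehlerRate z)) else 1

theorem mehlerExt_of_re_pos {z : ℂ} (hz : 0 < z.re) :
    W.mehlerExt z = mehlerConst d z • W.weylOp (gaussianKernel (mehlerRate z)) := if_pos hz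

theorem mehlerExt_zero : W.mehlerExt 0 = 1 := if_neg (by simp)

theorem mehlerExt_add [CompleteSpace X] {z w : ℂ} (hz : 0 < z.re) (hw : 0 < w.re) :
    W.mehlerExt (z + w) = W.mehlerExt z * W.mehlerExt w := by
  have hzw : 0 < (z + w).re := by
    rw [add_re]
    positivity
  have hr := mehlerRate_re_pos hzw
  rw [W.mehlerExt_of_re_pos hz, W.mehlerExt_of_re_pos hw, W.mehlerExt_of_re_pos hzw,
    smul_mul_smul_comm, ← mehlerRate_add hz hw, W.weylOp_gaussianKernel_mul (mehlerRate_re_pos hz)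
      (mehlerRate_re_pos hw) (by rwa [mehlerRate_add hz hw]), smul_smul, mehlerConst_mul d hz hw]

/-- The derivative of `P(z)`. -/
noncomputable def mehlerExtDeriv (z : ℂ) : X →L[ℂ] X :=
  mehlerConst d z • ((1 / 8 - 2 * mehlerRate z ^ 2) •
      W.weylOp (fun w => -((‖w‖ : ℝ) : ℂ) ^ 2 * gaussianKernel (mehlerRate z) w)) +
    (mehlerConst d z * (d / 2 - 2 * mehlerRate z * d)) • W.weylOp (gaussianKernel (mehlerRate z))

theorem hasDerivAt_mehlerExt {z : ℂ} (hz : 0 < z.re) :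
    HasDerivAt W.mehlerExt (W.mehlerExtDeriv z) z := by
  have h1 := (W.hasDerivAt_weylOp_gaussianKernel (mehlerRate_re_pos hz)).scomp z
    (hasDerivAt_mehlerRate hz)
  refine ((hasDerivAt_mehlerConst d hz).smul h1).congr_of_eventuallyEq ?_
  filter_upwards [(isOpen_lt continuous_const continuous_re).mem_nhds hz] with w hw
  exact W.mehlerExt_of_re_pos hw

theorem norm_mehlerConst_mul (d : ℕ) {z : ℂ} (hz : 0 < z.re) :
    ‖mehlerConst d z‖ * (Real.pi / (mehlerRate z).re) ^ d =
      (2 * ‖1 - Complex.exp (-z)‖ / (1 - ‖Complex.exp (-z)‖ ^ 2)) ^ d := by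
  have h1 := norm_pos_iff.2 (one_sub_exp_neg_ne_zero hz)
  have hden : 1 - ‖Complex.exp (-z)‖ ^ 2 ≠ 0 := by
    nlinarith [norm_nonneg (Complex.exp (-z)), norm_exp_neg_lt_one hz]
  rw [mehlerConst, mehlerRate_re, norm_inv, norm_pow, norm_mul, norm_mul, norm_real,
    Real.norm_of_nonneg Real.pi_pos.le, Complex.norm_ofNat, ← inv_pow, ← mul_pow]
  congr 1
  field_simp
  norm_num

theorem exists_norm_mehlerExt_le {θ : ℝ} (h0 : 0 < θ) (hθ : θ < Real.pi / 2) :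
    ∃ M : ℝ, ∀ z ∈ sector θ, ‖W.mehlerExt z‖ ≤ M := by
  obtain ⟨M, hM⟩ := W.norm_weylExp_le
  have hM0 := (norm_nonneg _).trans (hM 0)
  have hcos : 0 < Real.cos θ := Real.cos_pos_of_mem_Ioo ⟨by linarith, hθ⟩
  refine ⟨M * (6 / Real.cos θ) ^ d, fun z hz => ?_⟩
  have hz0 := re_pos_of_mem_sector hθ.le hz
  have hα := mehlerRate_re_pos hz0
  have h1 := norm_one_sub_exp_neg_div_le hcos (norm_mul_cos_le_re hθ.le hz) hz0
  have h2 := W.norm_weylOp_le hM (isRapidlyDecaying_gaussianKernel (d := d) hα).integrable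
  rw [integral_norm_gaussianKernel hα] at h2
  rw [W.mehlerExt_of_re_pos hz0, norm_smul]
  calc _ ≤ ‖mehlerConst d z‖ * (M * (Real.pi / (mehlerRate z).re) ^ d) := by gcongr
    _ = M * (‖mehlerConst d z‖ * (Real.pi / (mehlerRate z).re) ^ d) := by ring
    _ = M * (2 * ‖1 - Complex.exp (-z)‖ / (1 - ‖Complex.exp (-z)‖ ^ 2)) ^ d := by
        rw [norm_mehlerConst_mul d hz0]
    _ ≤ _ := by
        have : 0 ≤ 1 - ‖Complex.exp (-z)‖ ^ 2 := by
          nlinarith [norm_nonneg (Complex.exp (-z)), norm_exp_neg_lt_one hz0]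
        gcongr

theorem tendsto_mehlerExt_apply [CompleteSpace X] {θ : ℝ} (h0 : 0 < θ) (hθ : θ < Real.pi / 2)
    (f : X) : Tendsto (fun z => W.mehlerExt z f) (𝓝[sector θ] 0) (𝓝 f) := by
  have hcos : 0 < Real.cos θ := Real.cos_pos_of_mem_Ioo ⟨by linarith, hθ⟩
  have hpi : (Real.pi : ℂ) ≠ 0 := by exact_mod_cast Real.pi_ne_zero
  set K := 6 / Real.cos θ with hK
  have hK0 : 0 < K := by positivity
  have hmem : ∀ᶠ z in 𝓝[sector θ] (0 : ℂ), z ∈ sector θ := self_mem_nhdsWithin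
  have hbound : ∀ z ∈ sector θ,
      2 * ‖1 - Complex.exp (-z)‖ / (1 - ‖Complex.exp (-z)‖ ^ 2) ≤ K := fun z hz =>
    norm_one_sub_exp_neg_div_le hcos (norm_mul_cos_le_re hθ.le hz) (re_pos_of_mem_sector hθ.le hz)
  have hexp : Tendsto (fun z : ℂ => Complex.exp (-z)) (𝓝[sector θ] 0) (𝓝 1) := by
    have : Continuous fun z : ℂ => Complex.exp (-z) := by fun_prop
    simpa using (this.tendsto 0).mono_left nhdsWithin_le_nhds
  have hρ : Tendsto (fun z => (mehlerRate z).re) (𝓝[sector θ] 0) atTop := by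
    have h1 : Tendsto (fun z : ℂ => 2 * K * ‖1 - Complex.exp (-z)‖) (𝓝[sector θ] 0) (𝓝[>] 0) := by
      refine tendsto_nhdsWithin_iff.2 ⟨?_, ?_⟩
      · have := ((hexp.const_sub 1).norm).const_mul (2 * K)
        simpa using this
      · filter_upwards [hmem] with z hz
        have := norm_pos_iff.2 (one_sub_exp_neg_ne_zero (re_pos_of_mem_sector hθ.le hz))
        exact mul_pos (by positivity) this
    refine tendsto_atTop_mono' _ ?_ (tendsto_inv_nhdsGT_zero.comp h1)
    filter_upwards [hmem] with z hz
    have hz0 := re_pos_of_mem_sector hθ.le hz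
    have h2 := norm_pos_iff.2 (one_sub_exp_neg_ne_zero hz0)
    have hden : 0 < 1 - ‖Complex.exp (-z)‖ ^ 2 := by
      nlinarith [norm_nonneg (Complex.exp (-z)), norm_exp_neg_lt_one hz0]
    have h3 := hbound z hz
    rw [div_le_iff₀ hden] at h3
    rw [Function.comp_apply, mehlerRate_re, inv_eq_one_div,
      div_le_div_iff₀ (by positivity) (by positivity)]
    nlinarith
  have h1 := ((W.tendsto_integral_gaussian_norm_sub f).comp hρ).const_mul (K ^ d)
  have h2 : Tendsto (fun z => ‖(2 / (1 + Complex.exp (-z))) ^ d - 1‖ * ‖f‖) (𝓝[sector θ] 0)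
      (𝓝 0) := by
    have : Tendsto (fun z => (2 / (1 + Complex.exp (-z))) ^ d - 1) (𝓝[sector θ] 0)
        (𝓝 ((2 / (1 + 1)) ^ d - 1)) :=
      (((tendsto_const_nhds.div (hexp.const_add 1) (by norm_num)).pow d).sub_const 1)
    rw [one_add_one_eq_two, div_self two_ne_zero, one_pow, sub_self] at this
    simpa using this.norm.mul_const ‖f‖
  have h3 := h1.add h2
  rw [mul_zero, add_zero] at h3
  rw [tendsto_iff_norm_sub_tendsto_zero]
  refine squeeze_zero' (Eventually.of_forall fun _ => norm_nonneg _) ?_ h3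
  filter_upwards [hmem] with z hz
  have hz0 := re_pos_of_mem_sector hθ.le hz
  have hα := mehlerRate_re_pos hz0
  have hα' : mehlerRate z ≠ 0 := fun h => by simp [h] at hα
  have hne := one_sub_exp_neg_ne_zero hz0
  have hden : 0 < 1 - ‖Complex.exp (-z)‖ ^ 2 := by
    nlinarith [norm_nonneg (Complex.exp (-z)), norm_exp_neg_lt_one hz0]
  -- the total mass of the kernel of `P(z)`, which tends to `1`
  have hmass : mehlerConst d z * (Real.pi / mehlerRate z) ^ d =
      (2 / (1 + Complex.exp (-z))) ^ d := by
    have h4 : 1 + Complex.exp (-z) ≠ 0 := fun h => hα' (by rw [mehlerRate, h, zero_div])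
    rw [mehlerConst, mehlerRate, ← inv_pow, ← mul_pow]
    congr 1
    field_simp
    norm_num
  have hsplit : W.mehlerExt z f - f = mehlerConst d z •
      (W.weylOp (gaussianKernel (mehlerRate z)) f - ((Real.pi / mehlerRate z) ^ d : ℂ) • f) +
      ((2 / (1 + Complex.exp (-z))) ^ d - 1) • f := by
    rw [W.mehlerExt_of_re_pos hz0, smul_apply, ← hmass]
    module
  rw [hsplit]
  refine (norm_add_le _ _).trans ?_
  rw [norm_smul, norm_smul]
  refine add_le_add ?_ le_rfl
  have h5 : ‖mehlerConst d z‖ ≤ K ^ d * ((mehlerRate z).re / Real.pi) ^ d := by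
    have h6 := norm_mehlerConst_mul d hz0
    have h7 : (2 * ‖1 - Complex.exp (-z)‖ / (1 - ‖Complex.exp (-z)‖ ^ 2)) ^ d ≤ K ^ d := by
      gcongr
      exact hbound z hz
    rw [← h6, ← inv_div, inv_pow, ← div_eq_mul_inv, div_le_iff₀ (by positivity)] at h7
    exact h7
  rw [Function.comp_apply, ← mul_assoc]
  gcongr
  exact W.norm_weylOp_gaussianKernel_apply_sub_le hα f

end WeylPair

/-! ### Properties of the semigroup -/

/-- The Fourier--Plancherel transform of the symbol `a_t` is the Gaussian kernel of `P(t)`, up to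
the normalising factor of the Weyl calculus. -/
theorem fourierPlancherel_mehlerSymbol {d : ℕ} {t : ℝ} (ht : 0 < t) (w : PhaseSpace d) :
    ((2 * (Real.pi : ℂ)) ^ d)⁻¹ * fourierPlancherel (mehlerSymbol d t ht) w =
      mehlerConst d t * gaussianKernel (mehlerRate t) w := by
  have hl := mehlerParam_pos ht
  have hq : ((Real.exp (-t) : ℝ) : ℂ) = Complex.exp (-(t : ℂ)) := by push_cast; rfl
  have hne := one_sub_exp_neg_ne_zero (z := t) (by simpa using ht)
  have hq1 : 1 + Complex.exp (-(t : ℂ)) ≠ 0 := by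
    rw [← hq]
    exact_mod_cast (by positivity : (0 : ℝ) < 1 + Real.exp (-t)).ne'
  have hlam : (mehlerParam t : ℂ) =
      (1 - Complex.exp (-(t : ℂ))) / (1 + Complex.exp (-(t : ℂ))) := by
    rw [mehlerParam]
    push_cast
    rfl
  have hpi : (Real.pi : ℂ) ≠ 0 := by exact_mod_cast Real.pi_ne_zero
  have h1 : ∀ z : PhaseSpace d, mehlerSymbol d t ht z *
      Complex.exp (-(I * ((inner ℝ z w : ℝ) : ℂ))) = (1 + (mehlerParam t : ℂ)) ^ d *
        Complex.exp (-(mehlerParam t : ℂ) * ((‖z‖ : ℝ) : ℂ) ^ 2 +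
          -I * ((inner ℝ w z : ℝ) : ℂ)) := by
    intro z
    have h2 : mehlerSymbol d t ht z = (1 + (mehlerParam t : ℂ)) ^ d *
      ((Real.exp (-mehlerParam t * ‖z‖ ^ 2) : ℝ) : ℂ) := rfl
    rw [h2, mul_assoc, ofReal_exp, ← Complex.exp_add, real_inner_comm]
    push_cast
    ring_nf
  simp only [fourierPlancherel, h1]
  rw [integral_const_mul,
    GaussianFourier.integral_cexp_neg_mul_sq_norm_add (by simpa using hl)]
  simp only [finrank_euclideanSpace, Fintype.card_sum, Fintype.card_fin]
  rw [show (((d + d : ℕ) : ℂ) / 2) = (d : ℂ) by push_cast; ring, cpow_natCast]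
  have h3 : ∀ a b c e g : ℂ, a * (b * (c * (e * g))) = (a * b * c * e) * g :=
    fun a b c e g => by ring
  rw [h3, mehlerConst, gaussianKernel, mehlerRate, hlam, ← inv_pow, ← inv_pow, ← mul_pow, ← mul_pow,
    ← mul_pow]
  congr 2
  · field_simp
    ring
  · rw [neg_sq, I_sq]
    field_simp

namespace WeylPair

variable {d : ℕ} {X : Type*} [NormedAddCommGroup X] [NormedSpace ℂ X] (W : WeylPair d X)

theorem mehlerExt_ofReal {t : ℝ} (ht : 0 ≤ t) : W.mehlerExt t = W.mehler t := by
  rcases ht.eq_or_lt with rfl | ht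
  · rw [ofReal_zero, mehlerExt_zero, mehler, dif_neg (lt_irrefl 0)]
  · have hz : 0 < (t : ℂ).re := by simpa using ht
    ext f
    rw [W.mehlerExt_of_re_pos hz, mehler, dif_pos ht, weylCalculus_apply, smul_apply,
      W.weylOp_apply (isRapidlyDecaying_gaussianKernel (mehlerRate_re_pos hz)).integrable,
      ← integral_smul, ← integral_smul]
    simp only [smul_smul, fourierPlancherel_mehlerSymbol]

theorem isAnalyticSemigroup_mehlerExt [CompleteSpace X] :
    IsAnalyticSemigroup (Real.pi / 2) W.mehlerExt where
  map_zero := W.mehlerExt_zero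
  map_add _ hz _ hw := W.mehlerExt_add (mem_sector_pi_div_two.1 hz) (mem_sector_pi_div_two.1 hw)
  differentiableOn _ hz :=
    (W.hasDerivAt_mehlerExt (mem_sector_pi_div_two.1 hz)).differentiableAt.differentiableWithinAt
  continuousOn_apply η h0 hη f := by
    intro z hz
    rcases hz with rfl | hz
    · rw [continuousWithinAt_insert_self, ContinuousWithinAt, W.mehlerExt_zero]
      exact W.tendsto_mehlerExt_apply h0 hη f
    · have h1 := (W.hasDerivAt_mehlerExt (re_pos_of_mem_sector hη.le hz)).continuousAt
      exact (h1.clm_apply continuousAt_const).continuousWithinAt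

theorem isC0Semigroup_mehler [CompleteSpace X] : IsC0Semigroup W.mehler where
  map_zero := dif_neg (lt_irrefl 0)
  map_add s t hs ht := by
    have h0 : W.mehler 0 = 1 := dif_neg (lt_irrefl 0)
    rcases hs.eq_or_lt with rfl | hs
    · rw [zero_add, h0, one_mul]
    rcases ht.eq_or_lt with rfl | ht
    · rw [add_zero, h0, mul_one]
    rw [← W.mehlerExt_ofReal hs.le, ← W.mehlerExt_ofReal ht.le,
      ← W.mehlerExt_ofReal (add_pos hs ht).le, ofReal_add]
    exact W.mehlerExt_add (by simpa using hs) (by simpa using ht)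
  continuousOn_apply f := by
    have h1 := W.isAnalyticSemigroup_mehlerExt.continuousOn_apply (Real.pi / 4)
      (by positivity) (by linarith [Real.pi_pos]) f
    have h2 : MapsTo (fun t : ℝ => (t : ℂ)) (Ici 0) (insert 0 (sector (Real.pi / 4))) := by
      intro t ht
      rcases (mem_Ici.1 ht).eq_or_lt with rfl | ht
      · exact Or.inl ofReal_zero
      · exact Or.inr (ofReal_mem_sector ht (by positivity))
    refine (h1.comp continuous_ofReal.continuousOn h2).congr fun t ht => ?_
    simp only [Function.comp_apply, W.mehlerExt_ofReal ht]

theorem hasDerivAt_mehler {t : ℝ} (ht : 0 < t) :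
    HasDerivAt W.mehler (W.mehlerExtDeriv t) t := by
  have h1 : HasDerivAt (fun s : ℝ => W.mehlerExt s) (W.mehlerExtDeriv t) t := by
    have h := (W.hasDerivAt_mehlerExt (z := t) (by simpa using ht)).scomp t
      Complex.ofRealCLM.hasDerivAt
    rw [Complex.ofRealCLM_apply, ofReal_one, one_smul] at h
    exact h
  refine h1.congr_of_eventuallyEq ?_
  filter_upwards [lt_mem_nhds ht] with s hs
  exact (W.mehlerExt_ofReal hs.le).symm

theorem mehler_apply_mem [CompleteSpace X] {t : ℝ} (ht : 0 < t) (f : X) :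
    W.mehler t f ∈ (W.sqA + W.sqB).domain := by
  have hz : 0 < (t : ℂ).re := by simpa using ht
  rw [mem_domain_sqA_add_sqB]
  intro i
  rw [← W.mehlerExt_ofReal ht.le, W.mehlerExt_of_re_pos hz, smul_apply]
  exact Submodule.smul_mem _ _ (W.weylOp_gaussianKernel_apply_mem (mehlerRate_re_pos hz) i f)

/-- On `D(A²) ∩ D(B²)` the generator of `(P(t))` is `-(A² + B²) / 2 + d / 2`. -/
theorem mem_graph_generator_mehler [CompleteSpace X] {f : X} (hf : f ∈ (W.sqA + W.sqB).domain) :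
    (f, -((1 / 2 : ℂ) • (W.sqA + W.sqB) ⟨f, hf⟩ - ((d : ℂ) / 2) • f)) ∈
      (generator (𝓝[>] (0 : ℝ)) W.mehler).graph := by
  rw [mem_graph_generator_iff_of_hasDerivAt W.isC0Semigroup_mehler fun t => W.hasDerivAt_mehler]
  intro t ht
  have hz : 0 < (t : ℂ).re := by simpa using ht
  rw [← W.mehlerExt_ofReal ht.le, W.mehlerExt_of_re_pos hz, mehlerExtDeriv, smul_apply, map_neg,
    map_sub, map_smul, map_smul,
    W.weylOp_gaussianKernel_apply_sqA_add_sqB (mehlerRate_re_pos hz) hf]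
  simp only [add_apply, smul_apply]
  module

theorem dense_domain_sqA_add_sqB [CompleteSpace X] :
    Dense ((W.sqA + W.sqB).domain : Set X) := by
  intro f
  have h := (W.isC0Semigroup_mehler.continuousOn_apply f 0 self_mem_Ici).tendsto
  rw [W.isC0Semigroup_mehler.map_zero] at h
  refine mem_closure_of_tendsto (h.mono_left (nhdsWithin_mono _ Ioi_subset_Ici_self)) ?_
  filter_upwards [self_mem_nhdsWithin] with t ht
  exact W.mehler_apply_mem ht f

end WeylPair

theorem mainTheorem4 {X : Type*} [NormedAddCommGroup X] [NormedSpace ℂ X] [CompleteSpace X]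
    {d : ℕ} (W : WeylPair d X) :
    -- `P` is a uniformly bounded `C₀`-semigroup
    IsC0Semigroup W.mehler ∧
    (∃ M : ℝ, ∀ t : ℝ, 0 ≤ t → ‖W.mehler t‖ ≤ M) ∧
    -- `D(A²) ∩ D(B²)`, the domain of `A² + B²`, is dense and a core for the generator `-L` of `P`
    Dense ((W.sqA + W.sqB).domain : Set X) ∧
    (generator (𝓝[>] (0 : ℝ)) W.mehler).HasCore (W.sqA + W.sqB).domain ∧
    -- on this core, `L = (A² + B²) / 2 - d / 2`
    (∀ (f : X) (hf : f ∈ (W.sqA + W.sqB).domain) (hfL : f ∈ W.L.domain),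
      W.L ⟨f, hfL⟩ = (1 / 2 : ℂ) • (W.sqA + W.sqB) ⟨f, hf⟩ - ((d : ℂ) / 2) • f) ∧
    -- analytic extension of angle `π / 2`, uniformly bounded on each smaller sector
    ∃ T : ℂ → X →L[ℂ] X,
      IsAnalyticSemigroup (Real.pi / 2) T ∧
      (∀ t : ℝ, 0 ≤ t → T t = W.mehler t) ∧
      ∀ θ : ℝ, 0 < θ → θ < Real.pi / 2 → ∃ M : ℝ, ∀ z ∈ sector θ, ‖T z‖ ≤ M := by
  refine ⟨W.isC0Semigroup_mehler, ?_, W.dense_domain_sqA_add_sqB,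
    hasCore_generator W.isC0Semigroup_mehler (fun t => W.hasDerivAt_mehler)
      (fun f hf => LinearPMap.mem_domain_of_mem_graph (W.mem_graph_generator_mehler hf))
      fun t => W.mehler_apply_mem,
    fun f hf hfL => ?_, W.mehlerExt, W.isAnalyticSemigroup_mehlerExt,
    fun t => W.mehlerExt_ofReal, fun θ => W.exists_norm_mehlerExt_le⟩
  · obtain ⟨M, hM⟩ := W.exists_norm_mehlerExt_le (θ := Real.pi / 4) (by positivity)
      (by linarith [Real.pi_pos])
    refine ⟨max M ‖W.mehler 0‖, fun t ht => ?_⟩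
    rcases ht.eq_or_lt with rfl | ht
    · exact le_max_right _ _
    · rw [← W.mehlerExt_ofReal ht.le]
      exact (hM t (ofReal_mem_sector ht (by positivity))).trans (le_max_left _ _)
  · have h1 := LinearPMap.mem_graph_snd_inj _ ((generator (𝓝[>] (0 : ℝ)) W.mehler).mem_graph
      ⟨f, hfL⟩) (W.mem_graph_generator_mehler hf) rfl
    rw [← neg_neg ((1 / 2 : ℂ) • (W.sqA + W.sqB) ⟨f, hf⟩ - ((d : ℂ) / 2) • f), ← h1]
    rfl
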